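/- Let $\mathbb K$ be an algebraically closed field of characteristic zero. A quadratic Lie superalgebra $(\mathfrak g,B)$ is a finite-dimensional Lie superalgebra $\mathfrak g=\mathfrak g_{\bar 0}\oplus\mathfrak g_{\bar 1}$ over $\mathbb K$ with a bilinear form $B$ that is even ($B(\mathfrak g_{\bar 0},\mathfrak g_{\bar 1})=0$), supersymmetric ($B(X,Y)=(-1)^{|X||Y|}B(Y,X)$ for homogeneous $X,Y$), non-degenerate and invariant ($B([X,Y],Z)=B(X,[Y,Z])$). An isometry is an isomorphism of Lie superalgebras (in particular even) that preserves the forms. A subspace $W$ is isotropic if $B(W,W)=0$. Solvable means that the derived series of $\mathfrak g$ reaches $0$. Let $\mathfrak h$ be a finite-dimensional Lie superalgebra, with coadjoint action $X\cdot F=-(-1)^{|X||F|}F\circ\mathrm{ad}(X)$ on $\mathfrak h^*$ for homogeneous $X\in\mathfrak h$, $F\in\mathfrak h^*$. Let $w:\mathfrak h\times\mathfrak h\to\mathfrak h^*$ be an even super-antisymmetric bilinear map such that, for all homogeneous $X,Y,Z$, $$\sum_{\text{cyclic}}(-1)^{|Z||X|}\bigl(X\cdot w(Y,Z)+w(X,[Y,Z])\bigr)=0,\qquad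 w(X,Y)(Z)=(-1)^{|X|(|Y|+|Z|)}w(Y,Z)(X)$$ (a supercyclic $2$-cocycle). The $T^*$-extension $T^*_w\mathfrak h$ of $\mathfrak h$ by means of $w$ is the space $\mathfrak h\oplus\mathfrak h^*$ with the bracket and form given, for homogeneous $X+F$, $Y+H$ (where $|X|=|F|$, $|Y|=|H|$), by $$[X+F,Y+H]=[X,Y]+w(X,Y)+X\cdot H-(-1)^{|X||Y|}\,Y\cdot F,\qquad \langle X+F,Y+H\rangle=F(Y)+(-1)^{|X||Y|}H(X).$$ **Theorem.** Let $(\mathfrak g,B)$ be a solvable quadratic Lie superalgebra over $\mathbb K$. Then $\mathfrak g$ contains an isotropic graded ideal $\mathfrak I$ of dimension $\lfloor \dim\mathfrak g/2\rfloor$ that is maximal among all isotropic graded vector subspaces of $\mathfrak g$ and has the following properties. 1. If $\dim\mathfrak g$ is even, then $(\mathfrak g,B)$ is isometric to some $T^*$-extension $T^*_w(\mathfrak g/\mathfrak I)$ of the Lie superalgebra $\mathfrak g/\mathfrak I$. 2. If $\dim\mathfrak g$ is odd, then there are a $T^*$-extension $T^*_w(\mathfrak g/\mathfrak I)$ of $\mathfrak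 g/\mathfrak I$ and a graded ideal $J$ of codimension one in it, on which the form $\langle\cdot,\cdot\rangle$ is non-degenerate, such that $(\mathfrak g,B)$ is isometric to $J$ with the restricted bracket and form. -/

import Mathlib

/-- The sign `(-1)^{ij}` for degrees `i, j` in `ℤ/2`. -/
def koszulSign (K : Type*) [Field K] (i j : ZMod 2) : K := (-1) ^ (i.val * j.val)

/-- A Lie superalgebra structure on a vector space over a field (of characteristic zero in the
intended use): a decomposition into an even part `gr 0` and an odd part `gr 1` together with a
bilinear bracket that is even, super-antisymmetric and satisfies the super Jacobi identity. -/
structure LieSuperalgebra (K : Type*) (g : Type*) [Field K] [AddCommGroup g] [Module K g] where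
  gr : ZMod 2 → Submodule K g
  isCompl : IsCompl (gr 0) (gr 1)
  bracket : g →ₗ[K] g →ₗ[K] g
  bracket_mem : ∀ i j : ZMod 2, ∀ x ∈ gr i, ∀ y ∈ gr j, bracket x y ∈ gr (i + j)
  skew : ∀ i j : ZMod 2, ∀ x ∈ gr i, ∀ y ∈ gr j,
    bracket x y = -(koszulSign K i j • bracket y x)
  jacobi : ∀ i j k : ZMod 2, ∀ x ∈ gr i, ∀ y ∈ gr j, ∀ z ∈ gr k,
    koszulSign K k i • bracket x (bracket y z) + koszulSign K i j • bracket y (bracket z x)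
      + koszulSign K j k • bracket z (bracket x y) = 0

namespace LieSuperalgebra

variable {K : Type*} [Field K]

lemma deg_cases (i : ZMod 2) : i = 0 ∨ i = 1 := by
  revert i; decide

@[simp] lemma koszulSign_zero_left (j : ZMod 2) : koszulSign K 0 j = 1 := by
  simp [koszulSign]

@[simp] lemma koszulSign_zero_right (i : ZMod 2) : koszulSign K i 0 = 1 := by
  simp [koszulSign]

@[simp] lemma koszulSign_one_one : koszulSign K 1 1 = -1 := by
  simp [koszulSign, ZMod.val_one]

lemma sum_deg {M : Type*} [AddCommMonoid M] (f : ZMod 2 → M) : ∑ i : ZMod 2, f i = f 0 + f 1 :=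
  Fin.sum_univ_two f

lemma one_add_one_deg : (1 : ZMod 2) + 1 = 0 := by decide

variable {g : Type*} [AddCommGroup g] [Module K g] (L : LieSuperalgebra K g)

lemma isCompl_gr (i : ZMod 2) : IsCompl (L.gr i) (L.gr (i + 1)) := by
  rcases deg_cases i with rfl | rfl
  · simpa using L.isCompl
  · simpa [one_add_one_deg] using L.isCompl.symm

/-- The projection onto the component of degree `i`. -/
noncomputable def proj (i : ZMod 2) : g →ₗ[K] g :=
  (L.gr i).projection (L.gr (i + 1)) (L.isCompl_gr i)

lemma proj_mem (i : ZMod 2) (x : g) : L.proj i x ∈ L.gr i :=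
  Submodule.projection_apply_mem _ x

lemma proj_of_mem {i : ZMod 2} {x : g} (hx : x ∈ L.gr i) : L.proj i x = x :=
  Submodule.projection_apply_of_mem_left _ hx

lemma proj_of_mem_ne {i j : ZMod 2} (hij : i ≠ j) {x : g} (hx : x ∈ L.gr j) :
    L.proj i x = 0 := by
  refine Submodule.projection_apply_of_mem_right _ ?_
  have : j = i + 1 := by
    clear hx
    revert i j; decide
  exact this ▸ hx

lemma proj_add_proj (x : g) : L.proj 0 x + L.proj 1 x = x := by
  have h := Submodule.projection_add_projection_eq_self (L.isCompl_gr 0) x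
  simpa [proj, one_add_one_deg] using h

lemma eq_zero_of_mem {x : g} (h0 : x ∈ L.gr 0) (h1 : x ∈ L.gr 1) : x = 0 :=
  Submodule.disjoint_def.mp L.isCompl.disjoint x h0 h1

/-! ### Graded subspaces, ideals, solvability -/

/-- `W` is a graded subspace: `W = (W ∩ g_0) ⊕ (W ∩ g_1)`. -/
def IsGradedSubspace (W : Submodule K g) : Prop :=
  W = (W ⊓ L.gr 0) ⊔ (W ⊓ L.gr 1)

/-- `I` is a graded (two-sided) ideal. -/
def IsGradedIdeal (I : Submodule K g) : Prop :=
  L.IsGradedSubspace I ∧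
    (∀ x : g, ∀ y ∈ I, L.bracket x y ∈ I) ∧ (∀ x : g, ∀ y ∈ I, L.bracket y x ∈ I)

/-- The derived series: `D⁰ = g` and `Dⁿ⁺¹ = [Dⁿ, Dⁿ]`. -/
def derived : ℕ → Submodule K g
  | 0 => ⊤
  | n + 1 => Submodule.span K
      {z | ∃ x ∈ derived n, ∃ y ∈ derived n, z = L.bracket x y}

/-- `g` is solvable: some term of its derived series vanishes. -/
def IsSolvable : Prop := ∃ n : ℕ, L.derived n = ⊥

/-- `B` is an invariant scalar product: supersymmetric, even, non-degenerate and invariant.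
A quadratic Lie superalgebra is a pair `(L, B)` with this property. -/
structure IsInvariantScalarProduct (B : LinearMap.BilinForm K g) : Prop where
  supersymm : ∀ i j : ZMod 2, ∀ x ∈ L.gr i, ∀ y ∈ L.gr j, B x y = koszulSign K i j * B y x
  even : ∀ x ∈ L.gr 0, ∀ y ∈ L.gr 1, B x y = 0
  nondegenerate : B.Nondegenerate
  invariant : ∀ x y z : g, B (L.bracket x y) z = B x (L.bracket y z)

/-- `W` is isotropic with respect to `B`: `B(W, W) = 0`. -/
def IsIsotropic (B : LinearMap.BilinForm K g) (W : Submodule K g) : Prop :=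
  ∀ x ∈ W, ∀ y ∈ W, B x y = 0

/-- Two Lie superalgebras with bilinear forms are isometric: there is an isomorphism of Lie
superalgebras (in particular even) that preserves the forms. -/
def IsIsometric {h : Type*} [AddCommGroup h] [Module K h]
    (L : LieSuperalgebra K g) (B : LinearMap.BilinForm K g)
    (M : LieSuperalgebra K h) (C : LinearMap.BilinForm K h) : Prop :=
  ∃ e : g ≃ₗ[K] h,
    (∀ i : ZMod 2, ∀ x ∈ L.gr i, e x ∈ M.gr i) ∧
    (∀ x y : g, e (L.bracket x y) = M.bracket (e x) (e y)) ∧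
    (∀ x y : g, C (e x) (e y) = B x y)

variable {L}

lemma IsGradedSubspace.proj_mem {W : Submodule K g} (hW : L.IsGradedSubspace W) {x : g}
    (hx : x ∈ W) (i : ZMod 2) : L.proj i x ∈ W := by
  rw [hW] at hx
  obtain ⟨a, ha, b, hb, rfl⟩ := Submodule.mem_sup.mp hx
  rw [map_add]
  rcases deg_cases i with rfl | rfl
  · rw [L.proj_of_mem ha.2, L.proj_of_mem_ne (by decide) hb.2, add_zero]
    exact ha.1
  · rw [L.proj_of_mem hb.2, L.proj_of_mem_ne (by decide) ha.2, zero_add]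
    exact hb.1

/-! ### Quotients by graded ideals and graded ideals as Lie superalgebras -/

/-- The Lie superalgebra `g / I` for a graded ideal `I`: the degree `i` part is the image of the
degree `i` part of `g`, and `[x + I, y + I] = [x, y] + I`. -/
def quotient (L : LieSuperalgebra K g) (I : Submodule K g) (hI : L.IsGradedIdeal I) :
    LieSuperalgebra K (g ⧸ I) where
  gr i := (L.gr i).map I.mkQ
  isCompl := by
    constructor
    · rw [Submodule.disjoint_def]
      rintro _ ⟨a, ha, rfl⟩ ⟨b, hb, hab⟩
      have h1 : b - a ∈ I := (Submodule.Quotient.eq I).mp hab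
      have h2 := hI.1.proj_mem h1 0
      rw [map_sub, L.proj_of_mem_ne (by decide) hb, L.proj_of_mem ha, zero_sub, neg_mem_iff] at h2
      exact (Submodule.Quotient.mk_eq_zero I).mpr h2
    · rw [codisjoint_iff, ← Submodule.map_sup, L.isCompl.sup_eq_top, Submodule.map_top,
        Submodule.range_mkQ]
  bracket := I.liftQ
    { toFun := fun x => I.mapQ I (L.bracket x) (fun y hy => hI.2.1 x y hy)
      map_add' := fun x y => by
        apply Submodule.linearMap_qext
        ext z
        simp
      map_smul' := fun c x => by
        apply Submodule.linearMap_qext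
        ext z
        simp }
    (fun x hx => by
      rw [LinearMap.mem_ker]
      apply Submodule.linearMap_qext
      ext z
      simpa using hI.2.2 z x hx)
  bracket_mem := by
    rintro i j _ ⟨x, hx, rfl⟩ _ ⟨y, hy, rfl⟩
    exact ⟨L.bracket x y, L.bracket_mem i j x hx y hy, rfl⟩
  skew := by
    rintro i j _ ⟨x, hx, rfl⟩ _ ⟨y, hy, rfl⟩
    exact congrArg I.mkQ (L.skew i j x hx y hy)
  jacobi := by
    rintro i j k _ ⟨x, hx, rfl⟩ _ ⟨y, hy, rfl⟩ _ ⟨z, hz, rfl⟩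
    exact congrArg I.mkQ (L.jacobi i j k x hx y hy z hz)

lemma quotient_bracket_mk (I : Submodule K g) (hI : L.IsGradedIdeal I) (x y : g) :
    (L.quotient I hI).bracket (Submodule.Quotient.mk x) (Submodule.Quotient.mk y)
      = Submodule.Quotient.mk (L.bracket x y) := rfl

/-- A graded ideal as a Lie superalgebra, with the induced grading and bracket. -/
def restrict (L : LieSuperalgebra K g) (J : Submodule K g) (hJ : L.IsGradedIdeal J) :
    LieSuperalgebra K J where
  gr i := (L.gr i).comap J.subtype
  isCompl := by
    constructor
    · rw [Submodule.disjoint_def]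
      rintro ⟨x, hx⟩ h0 h1
      exact Subtype.ext (L.eq_zero_of_mem h0 h1)
    · rw [codisjoint_iff, Submodule.eq_top_iff']
      rintro ⟨x, hx⟩
      refine Submodule.mem_sup.mpr
        ⟨⟨L.proj 0 x, hJ.1.proj_mem hx 0⟩, L.proj_mem 0 x,
          ⟨L.proj 1 x, hJ.1.proj_mem hx 1⟩, L.proj_mem 1 x, ?_⟩
      exact Subtype.ext (L.proj_add_proj x)
  bracket := LinearMap.mk₂ K
    (fun x y => (⟨L.bracket x y, hJ.2.1 x y y.2⟩ : J))
    (fun x y z => Subtype.ext (by simp))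
    (fun c x y => Subtype.ext (by simp))
    (fun x y z => Subtype.ext (by simp))
    (fun c x y => Subtype.ext (by simp))
  bracket_mem i j x hx y hy := L.bracket_mem i j x hx y hy
  skew i j x hx y hy := Subtype.ext (L.skew i j x hx y hy)
  jacobi i j k x hx y hy z hz := Subtype.ext (L.jacobi i j k x hx y hy z hz)

variable (L)

/-! ### The coadjoint representation and `T*`-extensions -/

/-- The degree `i` part of the dual space: forms that vanish on the other component of `g`. -/
def dualGr (i : ZMod 2) : Submodule K (Module.Dual K g) where
  carrier := {F | ∀ j : ZMod 2, j ≠ i → ∀ x ∈ L.gr j, F x = 0}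
  add_mem' := fun {F G} hF hG j hj x hx => by
    rw [LinearMap.add_apply, hF j hj x hx, hG j hj x hx, add_zero]
  zero_mem' := fun _ _ _ _ => rfl
  smul_mem' := fun c F hF j hj x hx => by
    rw [LinearMap.smul_apply, hF j hj x hx, smul_zero]

/-- The coadjoint representation `X.F = -(-1)^{|X||F|} F ∘ ad X` for homogeneous `X` and `F`,
extended bilinearly; the component of `F` of degree `j` is `F ∘ proj j`. -/
noncomputable def coad : g →ₗ[K] Module.Dual K g →ₗ[K] Module.Dual K g :=
  LinearMap.mk₂ K
    (fun X F => -∑ i : ZMod 2, ∑ j : ZMod 2,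
      koszulSign K i j • (F ∘ₗ L.proj j ∘ₗ L.bracket (L.proj i X)))
    (fun X Y F => by ext z; simp [sum_deg]; ring)
    (fun c X F => by ext z; simp [sum_deg])
    (fun X F G => by ext z; simp [sum_deg]; ring)
    (fun c X F => by ext z; simp [sum_deg])


lemma dual_proj_apply {j : ZMod 2} {F : Module.Dual K g} (hF : F ∈ L.dualGr j) (i : ZMod 2)
    (x : g) : F (L.proj i x) = if i = j then F x else 0 := by
  split_ifs with h
  · subst h
    conv_rhs => rw [← L.proj_add_proj x, map_add]
    rcases deg_cases i with rfl | rfl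
    · rw [hF 1 (by decide) _ (L.proj_mem 1 x), add_zero]
    · rw [hF 0 (by decide) _ (L.proj_mem 0 x), zero_add]
  · exact hF i h _ (L.proj_mem i x)

/-- On homogeneous elements `coad` is given by the usual formula. -/
lemma coad_apply_of_mem {i j : ZMod 2} {X : g} (hX : X ∈ L.gr i) {F : Module.Dual K g}
    (hF : F ∈ L.dualGr j) (Z : g) :
    L.coad X F Z = -(koszulSign K i j * F (L.bracket X Z)) := by
  have h0 : ∀ k : ZMod 2, L.proj k X = if k = i then X else 0 := by
    intro k
    split_ifs with h
    · subst h; exact L.proj_of_mem hX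
    · exact L.proj_of_mem_ne h hX
  rcases deg_cases i with rfl | rfl <;> rcases deg_cases j with rfl | rfl <;>
    simp [coad, sum_deg, h0, L.dual_proj_apply hF]

/-- `w` is an even super-antisymmetric 2-cocycle of `g` with values in the coadjoint module
`g*` which is moreover supercyclic. -/
structure IsSupercyclicCocycle (w : g →ₗ[K] g →ₗ[K] Module.Dual K g) : Prop where
  even : ∀ i j : ZMod 2, ∀ X ∈ L.gr i, ∀ Y ∈ L.gr j, w X Y ∈ L.dualGr (i + j)
  skew : ∀ i j : ZMod 2, ∀ X ∈ L.gr i, ∀ Y ∈ L.gr j, w X Y = -(koszulSign K i j • w Y X)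
  cocycle : ∀ i j k : ZMod 2, ∀ X ∈ L.gr i, ∀ Y ∈ L.gr j, ∀ Z ∈ L.gr k,
    koszulSign K k i • (L.coad X (w Y Z) + w X (L.bracket Y Z))
      + koszulSign K i j • (L.coad Y (w Z X) + w Y (L.bracket Z X))
      + koszulSign K j k • (L.coad Z (w X Y) + w Z (L.bracket X Y)) = 0
  supercyclic : ∀ i j k : ZMod 2, ∀ X ∈ L.gr i, ∀ Y ∈ L.gr j, ∀ Z ∈ L.gr k,
    w X Y Z = koszulSign K i (j + k) * w Y Z X

/-- The bracket `[X + F, Y + H] = [X, Y] + w(X, Y) + X.H - (-1)^{|X||Y|} Y.F` on `g ⊕ g*`. For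
homogeneous elements (with `|X| = |F|` and `|Y| = |H|`) the last term `-(-1)^{|F||Y|} Y.F` is
`F ∘ ad Y`, whence the form in which it is written here; see `tStarBracket_of_mem`. -/
noncomputable def tStarBracket (w : g →ₗ[K] g →ₗ[K] Module.Dual K g) :
    (g × Module.Dual K g) →ₗ[K] (g × Module.Dual K g) →ₗ[K] (g × Module.Dual K g) :=
  LinearMap.mk₂ K
    (fun p q => (L.bracket p.1 q.1, w p.1 q.1 + L.coad p.1 q.2 + p.2 ∘ₗ L.bracket q.1))
    (fun p p' q => by
      ext <;> simp
      ring)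
    (fun c p q => by ext <;> simp)
    (fun p q q' => by
      ext <;> simp
      ring)
    (fun c p q => by ext <;> simp)

lemma tStarBracket_of_mem (w : g →ₗ[K] g →ₗ[K] Module.Dual K g) {i j : ZMod 2}
    {X Y : g} {F H : Module.Dual K g} (hF : F ∈ L.dualGr i) (hY : Y ∈ L.gr j) :
    L.tStarBracket w (X, F) (Y, H)
      = (L.bracket X Y, w X Y + L.coad X H - koszulSign K i j • L.coad Y F) := by
  refine Prod.ext rfl ?_
  ext Z
  have h := L.coad_apply_of_mem hY hF Z
  rcases deg_cases i with rfl | rfl <;> rcases deg_cases j with rfl | rfl <;>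
    simp [tStarBracket, h]

lemma bracket_bracket {i j : ZMod 2} {X Y : g} (hX : X ∈ L.gr i) (hY : Y ∈ L.gr j) (Z : g) :
    L.bracket (L.bracket X Y) Z
      = L.bracket X (L.bracket Y Z) - koszulSign K i j • L.bracket Y (L.bracket X Z) := by
  have key : ∀ k : ZMod 2, ∀ Z ∈ L.gr k, L.bracket (L.bracket X Y) Z
      = L.bracket X (L.bracket Y Z) - koszulSign K i j • L.bracket Y (L.bracket X Z) := by
    intro k Z hZ
    have h1 := L.jacobi i j k X hX Y hY Z hZ
    have h2 := L.skew k (i + j) Z hZ _ (L.bracket_mem i j X hX Y hY)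
    have h3 := L.skew k i Z hZ X hX
    rw [h2, h3] at h1
    simp only [map_neg, map_smul] at h1
    rcases deg_cases i with rfl | rfl <;> rcases deg_cases j with rfl | rfl <;>
      rcases deg_cases k with rfl | rfl <;>
      simp [one_add_one_deg] at h1 ⊢ <;>
      first
        | linear_combination (norm := module) (1 : K) • h1
        | linear_combination (norm := module) (-1 : K) • h1
  conv_lhs => rw [← L.proj_add_proj Z]
  conv_rhs => rw [← L.proj_add_proj Z]
  rw [map_add, key 0 _ (L.proj_mem 0 Z), key 1 _ (L.proj_mem 1 Z)]
  simp only [map_add, smul_add]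
  abel

lemma coad_mem {i j : ZMod 2} {X : g} (hX : X ∈ L.gr i) {F : Module.Dual K g}
    (hF : F ∈ L.dualGr j) : L.coad X F ∈ L.dualGr (i + j) := by
  intro k hk z hz
  rw [L.coad_apply_of_mem hX hF, hF (i + k) _ _ (L.bracket_mem i k X hX z hz), mul_zero, neg_zero]
  clear hX hF hz
  revert i j k; decide

/-- The `T*`-extension of `g` by means of a supercyclic 2-cocycle `w`, as a Lie superalgebra. -/
noncomputable def tStar (w : g →ₗ[K] g →ₗ[K] Module.Dual K g) (hw : L.IsSupercyclicCocycle w) :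
    LieSuperalgebra K (g × Module.Dual K g) where
  gr i := (L.gr i).prod (L.dualGr i)
  isCompl := by
    constructor
    · rw [Submodule.disjoint_def]
      rintro ⟨x, F⟩ ⟨hx, hF⟩ ⟨hx', hF'⟩
      refine Prod.ext (L.eq_zero_of_mem hx hx') ?_
      ext z
      change F z = 0
      rw [← L.proj_add_proj z, map_add, hF' 0 (by decide) _ (L.proj_mem 0 z),
        hF 1 (by decide) _ (L.proj_mem 1 z), add_zero]
    · rw [codisjoint_iff, Submodule.eq_top_iff']
      rintro ⟨x, F⟩
      refine Submodule.mem_sup.mpr ⟨(L.proj 0 x, F ∘ₗ L.proj 0), ⟨L.proj_mem 0 x, ?_⟩,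
        (L.proj 1 x, F ∘ₗ L.proj 1), ⟨L.proj_mem 1 x, ?_⟩, ?_⟩
      · intro j hj z hz
        simp [L.proj_of_mem_ne hj.symm hz]
      · intro j hj z hz
        simp [L.proj_of_mem_ne hj.symm hz]
      · refine Prod.ext (L.proj_add_proj x) ?_
        ext z
        simp [← map_add, L.proj_add_proj z]
  bracket := L.tStarBracket w
  bracket_mem := by
    rintro i j ⟨X, F⟩ ⟨hX, hF⟩ ⟨Y, H⟩ ⟨hY, hH⟩
    rw [L.tStarBracket_of_mem w hF hY]
    refine ⟨L.bracket_mem i j X hX Y hY, ?_⟩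
    refine sub_mem (add_mem (hw.even i j X hX Y hY) (L.coad_mem hX hH)) ?_
    exact Submodule.smul_mem _ _ (add_comm j i ▸ L.coad_mem hY hF)
  skew := by
    rintro i j ⟨X, F⟩ ⟨hX, hF⟩ ⟨Y, H⟩ ⟨hY, hH⟩
    rw [L.tStarBracket_of_mem w hF hY, L.tStarBracket_of_mem w hH hX]
    refine Prod.ext (L.skew i j X hX Y hY) ?_
    change _ = -(koszulSign K i j • (_ : Module.Dual K g))
    rw [hw.skew i j X hX Y hY]
    rcases deg_cases i with rfl | rfl <;> rcases deg_cases j with rfl | rfl <;>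
      simp <;> module
  jacobi := by
    rintro i j k ⟨X, F⟩ ⟨hX, hF⟩ ⟨Y, H⟩ ⟨hY, hH⟩ ⟨Z, G⟩ ⟨hZ, hG⟩
    refine Prod.ext (L.jacobi i j k X hX Y hY Z hZ) ?_
    ext T
    have hc := LinearMap.congr_fun (hw.cocycle i j k X hX Y hY Z hZ) T
    have e1 := L.bracket_bracket hX hY T
    have e2 := L.bracket_bracket hY hZ T
    have e3 := L.bracket_bracket hZ hX T
    have a1 : ∀ {a b : ZMod 2} {A : g} {P : Module.Dual K g}, A ∈ L.gr a →
        P ∈ L.dualGr b → P ∘ₗ L.bracket A ∈ L.dualGr (a + b) := by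
      intro a b A P hA hP m hm z hz
      refine hP (a + m) ?_ _ (L.bracket_mem a m A hA z hz)
      clear hA hP hz
      revert a b m; decide
    have c2 : ∀ {a b c : ZMod 2} {A B : g} {P : Module.Dual K g}, A ∈ L.gr a → B ∈ L.gr b →
        P ∈ L.dualGr c → L.coad A (L.coad B P) T
          = koszulSign K a (b + c) * (koszulSign K b c * P (L.bracket B (L.bracket A T))) := by
      intro a b c A B P hA hB hP
      rw [L.coad_apply_of_mem hA (L.coad_mem hB hP), L.coad_apply_of_mem hB hP]
      ring
    have c3 : ∀ {a b c : ZMod 2} {A B : g} {P : Module.Dual K g}, A ∈ L.gr a → B ∈ L.gr b →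
        P ∈ L.dualGr c → L.coad A (P ∘ₗ L.bracket B) T
          = -(koszulSign K a (b + c) * P (L.bracket B (L.bracket A T))) := by
      intro a b c A B P hA hB hP
      rw [L.coad_apply_of_mem hA (a1 hB hP)]
      rfl
    have f1 := congrArg (fun v => koszulSign K j k * G v) e1
    have f2 := congrArg (fun v => koszulSign K k i * F v) e2
    have f3 := congrArg (fun v => koszulSign K i j * H v) e3
    simp only [tStarBracket, LinearMap.mk₂_apply, map_add, LinearMap.add_apply, Prod.snd_add,
      Prod.smul_snd, LinearMap.smul_apply, LinearMap.comp_apply, smul_eq_mul, map_sub, map_smul,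
      c2 hX hY hG, c2 hY hZ hF, c2 hZ hX hH, c3 hX hZ hH, c3 hY hX hG, c3 hZ hY hF,
      Prod.snd_zero, LinearMap.zero_apply] at hc f1 f2 f3 ⊢
    clear a1 c2 c3 e1 e2 e3 hX hY hZ hF hG hH
    rcases deg_cases i with rfl | rfl <;> rcases deg_cases j with rfl | rfl <;>
      rcases deg_cases k with rfl | rfl <;>
      simp only [koszulSign_zero_left, koszulSign_zero_right, koszulSign_one_one,
        one_add_one_deg, add_zero, zero_add] at hc f1 f2 f3 ⊢ <;>
      linear_combination hc + f1 + f2 + f3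

/-- The bilinear form `B(X + F, Y + H) = F(Y) + (-1)^{|X||Y|} H(X)` on `g ⊕ g*`, where
`|X| = |F|` and `|Y| = |H|`. As `H(X)` vanishes for homogeneous `X`, `H` of different degrees,
only the terms `(-1)^{|X||X|} H(X)` matter. -/
noncomputable def tStarForm : LinearMap.BilinForm K (g × Module.Dual K g) :=
  LinearMap.mk₂ K
    (fun p q => p.2 q.1 + ∑ i : ZMod 2, koszulSign K i i * q.2 (L.proj i p.1))
    (fun p p' q => by simp [sum_deg]; ring)
    (fun c p q => by simp [sum_deg]; ring)
    (fun p q q' => by simp [sum_deg]; ring)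
    (fun c p q => by simp [sum_deg]; ring)

lemma tStarForm_of_mem {i j : ZMod 2} {X Y : g} {F H : Module.Dual K g} (hX : X ∈ L.gr i)
    (hH : H ∈ L.dualGr j) :
    L.tStarForm (X, F) (Y, H) = F Y + koszulSign K i j * H X := by
  rcases deg_cases i with rfl | rfl <;> rcases deg_cases j with rfl | rfl
  · simp [tStarForm, sum_deg, L.dual_proj_apply hH]
  · simp [tStarForm, sum_deg, L.dual_proj_apply hH, L.proj_of_mem_ne (by decide : (1 : ZMod 2) ≠ 0) hX, hH 0 (by decide) X hX]
  · simp [tStarForm, sum_deg, L.dual_proj_apply hH, L.proj_of_mem_ne (by decide : (0 : ZMod 2) ≠ 1) hX, hH 1 (by decide) X hX]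
  · simp [tStarForm, sum_deg, L.dual_proj_apply hH]

end LieSuperalgebra

/-! ### Graded ideals, the derived series and orthogonal complements. -/

namespace LieSuperalgebra

section Basics

variable {K : Type*} [Field K] {g : Type*} [AddCommGroup g] [Module K g]
  {L : LieSuperalgebra K g}

/-! Take an isotropic graded ideal `W` maximal among such ideals. Then `W^⊥ / W` is a module with
invariant form, and it is anisotropic: an isotropic graded submodule would lift to a larger
isotropic graded ideal. The crux is that a solvable `g` acts by zero on every anisotropic module `U`
(`IsAnisotropic.act_eq_zero_of_isSolvable`). One climbs the derived series from its vanishing term,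
so it suffices to treat a graded ideal `A` with `[A, A]` acting by zero. For even `a ∈ A`, the
generalized eigenspaces with nonzero eigenvalue are isotropic graded submodules, hence zero, so `a`
acts nilpotently; odd elements of `A` square to zero. If `A U ≠ 0`, the supercommuting nilpotent
operators share a nonzero kernel vector in `A U`. But `A U ∩ U^A` is an isotropic graded submodule,
hence zero, so `A U = 0`.

Consequently `[g, W^⊥] ⊆ W`, and every graded subspace between `W` and `W^⊥` is an ideal. Maximality
now says that homogeneous isotropic vectors of `W^⊥` lie in `W`. Odd vectors are always isotropic,
and over an algebraically closed field a quadratic form in two variables has a nontrivial zero, so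
`dim W^⊥ / W ≤ 1` (`exists_isotropic_gradedIdeal`). This gives the dimension of `W` and its
maximality among isotropic graded subspaces.

If `W^⊥ = W`, an even isotropic complement of `W` can be identified with `h = g / W` and `W` with
`h^*` through the form, which is a `T*`-extension (`exists_isIsometric_tStar`). If `W^⊥ = W ⊕ K v`
with `B(v, v) = 1`, adjoin a central even line `K e` with `B(e, e) = -1`. Then `W ⊕ K (v + e)` is a
Lagrangian ideal of `g ⊕ K e` with quotient `g / W`, the Lagrangian case applies, and `g` is the
ideal `e^⊥` of codimension one. -/

lemma koszulSign_mul_self (i j : ZMod 2) : koszulSign K i j * koszulSign K i j = 1 := by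
  rcases deg_cases i with rfl | rfl <;> rcases deg_cases j with rfl | rfl <;> simp

lemma koszulSign_comm (i j : ZMod 2) : koszulSign K i j = koszulSign K j i := by
  simp [koszulSign, mul_comm]

/-- To check an additive property it suffices to check it on homogeneous elements. -/
@[elab_as_elim]
lemma homogeneous_induction {p : g → Prop} (L : LieSuperalgebra K g)
    (hadd : ∀ x y, p x → p y → p (x + y)) (hom : ∀ i, ∀ x ∈ L.gr i, p x) (x : g) : p x := by
  rw [← L.proj_add_proj x]
  exact hadd _ _ (hom 0 _ (L.proj_mem 0 x)) (hom 1 _ (L.proj_mem 1 x))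

lemma isGradedSubspace_of_proj_mem {W : Submodule K g}
    (h : ∀ i, ∀ x ∈ W, L.proj i x ∈ W) : L.IsGradedSubspace W := by
  refine le_antisymm (fun x hx => ?_) (sup_le inf_le_left inf_le_left)
  exact Submodule.mem_sup.mpr ⟨L.proj 0 x, ⟨h 0 x hx, L.proj_mem 0 x⟩, L.proj 1 x,
    ⟨h 1 x hx, L.proj_mem 1 x⟩, L.proj_add_proj x⟩

lemma proj_bracket {i : ZMod 2} {x : g} (hx : x ∈ L.gr i) (j : ZMod 2) (y : g) :
    L.proj (i + j) (L.bracket x y) = L.bracket x (L.proj j y) := by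
  refine L.homogeneous_induction (fun y z hy hz => by simp only [map_add, hy, hz]) ?_ y
  intro k y hy
  by_cases hjk : j = k
  · subst hjk
    rw [L.proj_of_mem (L.bracket_mem i j x hx y hy), L.proj_of_mem hy]
  · rw [L.proj_of_mem_ne (by simpa using hjk) (L.bracket_mem i k x hx y hy),
      L.proj_of_mem_ne hjk hy, map_zero]

/-- For a graded subspace, being a left ideal suffices to be a graded ideal. -/
lemma isGradedIdeal_of_left {W : Submodule K g} (hW : L.IsGradedSubspace W)
    (h : ∀ x, ∀ y ∈ W, L.bracket x y ∈ W) : L.IsGradedIdeal W := by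
  refine ⟨hW, h, fun x y hy => ?_⟩
  have key : ∀ i, ∀ y ∈ L.gr i, y ∈ W → L.bracket y x ∈ W := by
    intro i y hy hyW
    refine L.homogeneous_induction (p := fun x => L.bracket y x ∈ W)
      (fun x x' hx hx' => by rw [map_add]; exact add_mem hx hx') (fun j x hx => ?_) x
    rw [L.skew i j y hy x hx]
    exact neg_mem (Submodule.smul_mem _ _ (h x y hyW))
  rw [← L.proj_add_proj y, map_add, LinearMap.add_apply]
  exact add_mem (key 0 _ (L.proj_mem 0 y) (hW.proj_mem hy 0))
    (key 1 _ (L.proj_mem 1 y) (hW.proj_mem hy 1))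

/-- For a graded subspace, being a right ideal suffices to be a graded ideal. -/
lemma isGradedIdeal_of_right {W : Submodule K g} (hW : L.IsGradedSubspace W)
    (h : ∀ x, ∀ y ∈ W, L.bracket y x ∈ W) : L.IsGradedIdeal W := by
  refine isGradedIdeal_of_left hW fun x y hy => ?_
  have key : ∀ i, ∀ y ∈ L.gr i, y ∈ W → L.bracket x y ∈ W := by
    intro i y hy hyW
    refine L.homogeneous_induction (p := fun x => L.bracket x y ∈ W)
      (fun x x' hx hx' => by rw [map_add]; exact add_mem hx hx') (fun j x hx => ?_) x
    rw [L.skew j i x hx y hy]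
    exact neg_mem (Submodule.smul_mem _ _ (h x y hyW))
  rw [← L.proj_add_proj y, map_add]
  exact add_mem (key 0 _ (L.proj_mem 0 y) (hW.proj_mem hy 0))
    (key 1 _ (L.proj_mem 1 y) (hW.proj_mem hy 1))

lemma proj_span_bracket_mem {D : Submodule K g} (hD : L.IsGradedSubspace D) (i : ZMod 2) {z : g}
    (hz : z ∈ Submodule.span K {z | ∃ x ∈ D, ∃ y ∈ D, z = L.bracket x y}) :
    L.proj i z ∈ Submodule.span K {z | ∃ x ∈ D, ∃ y ∈ D, z = L.bracket x y} := by
  induction hz using Submodule.span_induction with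
  | mem z hz =>
    obtain ⟨x, hx, y, hy, rfl⟩ := hz
    -- Only `x` needs to be split: bracketing with its degree `k` component shifts degrees by `k`,
    -- and `k + (k + i) = i` in `ℤ/2`.
    have key : ∀ k, L.proj i (L.bracket (L.proj k x) y)
        = L.bracket (L.proj k x) (L.proj (k + i) y) := by
      intro k
      rw [← proj_bracket (L.proj_mem k x)]
      congr 2
      revert i k; decide
    conv in L.bracket x y => rw [← L.proj_add_proj x]
    rw [map_add, LinearMap.add_apply, map_add, key, key]
    exact add_mem (Submodule.subset_span ⟨_, hD.proj_mem hx 0, _, hD.proj_mem hy _, rfl⟩)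
      (Submodule.subset_span ⟨_, hD.proj_mem hx 1, _, hD.proj_mem hy _, rfl⟩)
  | zero => simp
  | add x y _ _ hx hy => rw [map_add]; exact add_mem hx hy
  | smul c x _ hx => rw [map_smul]; exact Submodule.smul_mem _ _ hx

lemma derived_isGradedIdeal (L : LieSuperalgebra K g) (n : ℕ) : L.IsGradedIdeal (L.derived n) := by
  induction n with
  | zero =>
    exact isGradedIdeal_of_left (isGradedSubspace_of_proj_mem fun _ _ _ => trivial)
      fun _ _ _ => trivial
  | succ n ih =>
    refine isGradedIdeal_of_left
      (isGradedSubspace_of_proj_mem fun i x hx => proj_span_bracket_mem ih.1 i hx) ?_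
    intro x y hy
    change y ∈ Submodule.span K {z | ∃ x ∈ L.derived n, ∃ y ∈ L.derived n, z = L.bracket x y} at hy
    change L.bracket x y ∈
      Submodule.span K {z | ∃ x ∈ L.derived n, ∃ y ∈ L.derived n, z = L.bracket x y}
    induction hy using Submodule.span_induction with
    | mem z hz =>
      obtain ⟨a, ha, b, hb, rfl⟩ := hz
      refine L.homogeneous_induction
        (fun x x' hx hx' => by rw [map_add, LinearMap.add_apply]; exact add_mem hx hx') ?_ x
      intro i x hx
      have key : ∀ j, L.bracket x (L.bracket (L.proj j a) b) ∈
          Submodule.span K {z | ∃ x ∈ L.derived n, ∃ y ∈ L.derived n, z = L.bracket x y} := by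
        intro j
        have hja := ih.1.proj_mem ha j
        -- The Jacobi identity in Leibniz form: `ad x` is a superderivation, so it preserves the
        -- span of brackets of an ideal.
        rw [eq_add_of_sub_eq (L.bracket_bracket hx (L.proj_mem j a) b).symm]
        refine add_mem (Submodule.subset_span ⟨_, ih.2.1 _ _ hja, _, hb, rfl⟩)
          (Submodule.smul_mem _ _ (Submodule.subset_span ⟨_, hja, _, ih.2.1 _ _ hb, rfl⟩))
      rw [← L.proj_add_proj a, map_add, LinearMap.add_apply, map_add]
      exact add_mem (key 0) (key 1)
    | zero => simp
    | add x y _ _ hx hy => rw [map_add]; exact add_mem hx hy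
    | smul c x _ hx => rw [map_smul]; exact Submodule.smul_mem _ _ hx

variable {B : LinearMap.BilinForm K g}

lemma IsInvariantScalarProduct.apply_eq_zero (hB : L.IsInvariantScalarProduct B) {i j : ZMod 2}
    (hij : i ≠ j) {x y : g} (hx : x ∈ L.gr i) (hy : y ∈ L.gr j) : B x y = 0 := by
  rcases deg_cases i with rfl | rfl <;> rcases deg_cases j with rfl | rfl
  · exact absurd rfl hij
  · exact hB.even x hx y hy
  · rw [hB.supersymm 1 0 x hx y hy, hB.even y hy x hx, mul_zero]
  · exact absurd rfl hij

lemma IsInvariantScalarProduct.apply_proj_left (hB : L.IsInvariantScalarProduct B) (i : ZMod 2)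
    (x y : g) : B (L.proj i x) y = B x (L.proj i y) := by
  refine L.homogeneous_induction (fun x x' hx hx' => by
    simp only [map_add, LinearMap.add_apply, hx, hx']) (fun j x hx => ?_) x
  refine L.homogeneous_induction (fun y y' hy hy' => by simp only [map_add, hy, hy'])
    (fun k y hy => ?_) y
  by_cases hj : i = j <;> by_cases hk : i = k
  · subst hj hk; rw [L.proj_of_mem hx, L.proj_of_mem hy]
  · subst hj; rw [L.proj_of_mem hx, L.proj_of_mem_ne hk hy, hB.apply_eq_zero hk hx hy, map_zero]
  · subst hk
    rw [L.proj_of_mem hy, L.proj_of_mem_ne hj hx, hB.apply_eq_zero (Ne.symm hj) hx hy, map_zero,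
      LinearMap.zero_apply]
  · rw [L.proj_of_mem_ne hj hx, L.proj_of_mem_ne hk hy, map_zero, map_zero, LinearMap.zero_apply]

/-- The subspace of all `x` with `B(x, W) = 0`. -/
def leftOrthogonal (B : LinearMap.BilinForm K g) (W : Submodule K g) : Submodule K g :=
  W.dualAnnihilator.comap B

lemma mem_leftOrthogonal {W : Submodule K g} {x : g} :
    x ∈ leftOrthogonal B W ↔ ∀ y ∈ W, B x y = 0 := by
  simp [leftOrthogonal, Submodule.mem_dualAnnihilator]

lemma finrank_leftOrthogonal [FiniteDimensional K g] (hB : B.Nondegenerate) (W : Submodule K g) :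
    Module.finrank K W + Module.finrank K (leftOrthogonal B W) = Module.finrank K g := by
  rw [← Subspace.finrank_add_finrank_dualAnnihilator_eq W]
  congr 1
  have : leftOrthogonal B W
      = W.dualAnnihilator.comap (LinearMap.BilinForm.toDual B hB).toLinearMap := rfl
  rw [this, Submodule.comap_equiv_eq_map_symm]
  exact LinearEquiv.finrank_map_eq _ _

lemma IsIsotropic.le_leftOrthogonal {W : Submodule K g} (hW : IsIsotropic B W) :
    W ≤ leftOrthogonal B W := fun x hx => mem_leftOrthogonal.mpr (hW x hx)

lemma IsIsotropic.two_mul_finrank_le [FiniteDimensional K g] (hB : B.Nondegenerate)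
    {W : Submodule K g} (hW : IsIsotropic B W) :
    2 * Module.finrank K W ≤ Module.finrank K g := by
  have h1 := Submodule.finrank_mono hW.le_leftOrthogonal
  have h2 := finrank_leftOrthogonal hB W
  omega

/-- Supersymmetry exchanges the arguments only for homogeneous vectors. Evenness of the form and
gradedness of `W` reduce to that case, so left and right orthogonality to `W` agree. -/
lemma IsInvariantScalarProduct.apply_comm_eq_zero (hB : L.IsInvariantScalarProduct B)
    {W : Submodule K g} (hW : L.IsGradedSubspace W) {x : g} (hx : ∀ y ∈ W, B x y = 0) :
    ∀ y ∈ W, B y x = 0 := by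
  intro y hy
  have key : ∀ i, B (L.proj i y) (L.proj i x) = 0 := by
    intro i
    rw [hB.supersymm i i _ (L.proj_mem i y) _ (L.proj_mem i x), hB.apply_proj_left,
      L.proj_of_mem (L.proj_mem i y), hx _ (hW.proj_mem hy i), mul_zero]
  have h2 : ∀ i, B (L.proj i y) x = 0 := fun i => by
    rw [← L.proj_of_mem (L.proj_mem i y), hB.apply_proj_left, key]
  rw [← L.proj_add_proj y, map_add, LinearMap.add_apply, h2, h2, add_zero]

lemma IsInvariantScalarProduct.leftOrthogonal_isGradedIdeal (hB : L.IsInvariantScalarProduct B)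
    {W : Submodule K g} (hW : L.IsGradedIdeal W) : L.IsGradedIdeal (leftOrthogonal B W) := by
  refine isGradedIdeal_of_right (isGradedSubspace_of_proj_mem fun i x hx => ?_) fun x y hy => ?_
  · rw [mem_leftOrthogonal] at hx ⊢
    intro y hy
    rw [hB.apply_proj_left]
    exact hx _ (hW.1.proj_mem hy i)
  · rw [mem_leftOrthogonal] at hy ⊢
    intro z hz
    rw [hB.invariant]
    exact hy _ (hW.2.1 x z hz)

end Basics

end LieSuperalgebra

/-! ### Solvable Lie superalgebras act trivially on anisotropic modules. -/

namespace LieSuperalgebra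

section OrthosymplecticModule

open Module

/-- A module over a Lie superalgebra with an invariant even bilinear form. The grading of the module
is given by its two projections. -/
structure OrthosymplecticModule {K g : Type*} [Field K] [AddCommGroup g] [Module K g]
    (L : LieSuperalgebra K g) (U : Type*) [AddCommGroup U] [Module K U] where
  act : g →ₗ[K] End K U
  proj : ZMod 2 → End K U
  form : LinearMap.BilinForm K U
  proj_add_proj : ∀ u, proj 0 u + proj 1 u = u
  proj_act : ∀ i j, ∀ x ∈ L.gr i, ∀ u, proj (i + j) (act x u) = act x (proj j u)
  act_bracket : ∀ i j, ∀ x ∈ L.gr i, ∀ y ∈ L.gr j, ∀ u,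
    act (L.bracket x y) u = act x (act y u) - koszulSign K i j • act y (act x u)
  form_proj_left : ∀ i u v, form (proj i u) v = form u (proj i v)
  form_act : ∀ i j, ∀ x ∈ L.gr i, ∀ u v,
    form (act x (proj j u)) v = -(koszulSign K i j * form (proj j u) (act x v))

namespace OrthosymplecticModule

variable {K : Type*} [Field K] {g : Type*} [AddCommGroup g] [Module K g]
  {L : LieSuperalgebra K g} {U : Type*} [AddCommGroup U] [Module K U]
  (M : L.OrthosymplecticModule U)

/-- The module has no nonzero isotropic graded submodule. -/
def IsAnisotropic : Prop :=
  ∀ P : Submodule K U, (∀ i, ∀ u ∈ P, M.proj i u ∈ P) → (∀ x, ∀ u ∈ P, M.act x u ∈ P) →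
    IsIsotropic M.form P → P = ⊥

lemma act_proj {i : ZMod 2} {x : g} (hx : x ∈ L.gr i) (j : ZMod 2) (u : U) :
    M.proj j (M.act x u) = M.act x (M.proj (i + j) u) := by
  rw [← M.proj_act i (i + j) x hx]
  congr 2
  clear hx
  revert i j; decide

lemma form_act_even {x : g} (hx : x ∈ L.gr 0) (u v : U) :
    M.form (M.act x u) v = -M.form u (M.act x v) := by
  conv_lhs => rw [← M.proj_add_proj u]
  rw [map_add, map_add, LinearMap.add_apply, M.form_act 0 0 x hx, M.form_act 0 1 x hx]
  conv_rhs => rw [← M.proj_add_proj u]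
  simp
  ring

/-- The operator `a` is skew for the form, so generalized eigenvectors pair nontrivially only for
opposite eigenvalues, and `c ≠ -c`. In the induction, applying `a - c` to either argument lowers `k
+ l`; hence `B(a u, v) = c B(u, v) = B(u, a v)`, and skewness gives `2 c B(u, v) = 0`. -/
lemma form_eq_zero_of_shifted_pow [NeZero (2 : K)] {a : g} (ha : a ∈ L.gr 0) {c : K} (hc : c ≠ 0) :
    ∀ n k l : ℕ, k + l = n → ∀ u v : U, ((M.act a - c • 1) ^ k) u = 0 →
      ((M.act a - c • 1) ^ l) v = 0 → M.form u v = 0 := by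
  intro n
  induction n with
  | zero =>
    intro k l hkl u v hu hv
    obtain ⟨rfl, rfl⟩ : k = 0 ∧ l = 0 := by omega
    have : u = 0 := by simpa using hu
    simp [this]
  | succ n ih =>
    intro k l hkl u v hu hv
    rcases k with _ | k
    · have : u = 0 := by simpa using hu
      simp [this]
    rcases l with _ | l
    · have : v = 0 := by simpa using hv
      simp [this]
    have h1 := ih k (l + 1) (by omega) ((M.act a - c • 1) u) v
      (by rw [pow_succ] at hu; exact hu) hv
    have h2 := ih (k + 1) l (by omega) u ((M.act a - c • 1) v) hu
      (by rw [pow_succ] at hv; exact hv)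
    have h3 := M.form_act_even ha u v
    simp only [LinearMap.sub_apply, LinearMap.smul_apply, End.one_apply, map_sub, map_smul,
      smul_eq_mul] at h1 h2
    have h4 : 2 * c * M.form u v = 0 := by linear_combination h3 - h1 - h2
    simpa [hc, two_ne_zero] using h4

/-- In effect `f ^ (k + 1) * y = y * f ^ (k + 1) + (k + 1) • (c * f ^ k)`, and both terms on the
right kill `u`. This makes generalized eigenspaces stable under operators that do not commute with
`f`. -/
lemma shifted_pow_apply {f y c : End K U} (hy : f * y = y * f + c) (hc : f * c = c * f) :
    ∀ (k : ℕ) (u : U), (f ^ k) u = 0 → (f ^ (k + 1)) (y u) = 0 := by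
  intro k
  induction k with
  | zero => intro u hu; have : u = 0 := by simpa using hu
            simp [this]
  | succ k ih =>
    intro u hu
    have h1 := ih (f u) (by rw [pow_succ] at hu; exact hu)
    have h2 : f (y u) = y (f u) + c u := LinearMap.congr_fun hy u
    have h3 : (f ^ (k + 1)) (c u) = c ((f ^ (k + 1)) u) :=
      LinearMap.congr_fun (Commute.pow_left (show Commute f c from hc) (k + 1)).eq u
    rw [pow_succ, Module.End.mul_apply, h2, map_add, h1, h3, hu, map_zero, add_zero]

variable {M}

/-- Even elements of an ideal `A` such that `[A, A]` acts trivially act nilpotently. -/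
lemma IsAnisotropic.exists_pow_even [IsAlgClosed K] [NeZero (2 : K)] [FiniteDimensional K U]
    (hM : M.IsAnisotropic) {A : Submodule K g} (hA : L.IsGradedIdeal A)
    (hAA : ∀ x ∈ A, ∀ y ∈ A, M.act (L.bracket x y) = 0) {a : g} (haA : a ∈ A) (ha : a ∈ L.gr 0)
    (u : U) : ∃ k, (M.act a ^ k) u = 0 := by
  have hbr : ∀ y u, M.act a (M.act y u) = M.act y (M.act a u) + M.act (L.bracket a y) u := by
    intro y
    refine L.homogeneous_induction (fun x y hx hy => ?_) (fun i x hx => ?_) y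
    · intro u
      simp only [map_add, LinearMap.add_apply, hx u, hy u]
      abel
    · intro u
      rw [M.act_bracket 0 i a ha x hx]
      simp
  -- Each such eigenspace is graded because `a` is even, is a submodule by `shifted_pow_apply`, and
  -- is isotropic since `2 c ≠ 0`.
  have h0 : ∀ c : K, c ≠ 0 → (M.act a).maxGenEigenspace c = ⊥ := by
    intro c hc
    refine hM _ (fun i u hu => ?_) (fun y u hu => ?_) (fun u hu v hv => ?_)
    · rw [End.mem_maxGenEigenspace] at hu ⊢
      obtain ⟨k, hk⟩ := hu
      refine ⟨k, ?_⟩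
      have hcomm : Commute (M.act a - c • 1) (M.proj i) := by
        refine LinearMap.ext fun w => ?_
        have := M.proj_act 0 i a ha w
        rw [zero_add] at this
        simp [this]
      have h := LinearMap.congr_fun (hcomm.pow_left k).eq u
      rw [Module.End.mul_apply, Module.End.mul_apply, hk, map_zero] at h
      exact h
    · rw [End.mem_maxGenEigenspace] at hu ⊢
      obtain ⟨k, hk⟩ := hu
      refine ⟨k + 1, shifted_pow_apply (c := M.act (L.bracket a y)) ?_ ?_ k u hk⟩
      · refine LinearMap.ext fun w => ?_
        have := hbr y w
        simp [this]
        abel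
      · refine LinearMap.ext fun w => ?_
        -- As `A` is an ideal, `[a, y] ∈ A`, so `[a, [a, y]] ∈ [A, A]` acts by zero and the
        -- commutator term commutes with `a`.
        have := hbr (L.bracket a y) w
        rw [hAA a haA _ (hA.2.2 y a haA)] at this
        simp [this]
    · rw [End.mem_maxGenEigenspace] at hu hv
      obtain ⟨k, hk⟩ := hu
      obtain ⟨l, hl⟩ := hv
      exact M.form_eq_zero_of_shifted_pow ha hc _ k l rfl u v hk hl
  have htop := End.iSup_maxGenEigenspace_eq_top (M.act a)
  have hu : u ∈ (M.act a).maxGenEigenspace 0 := by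
    have hle : ⨆ c, (M.act a).maxGenEigenspace c ≤ (M.act a).maxGenEigenspace 0 := by
      refine iSup_le fun c => ?_
      by_cases hc : c = 0
      · rw [hc]
      · rw [h0 c hc]; exact bot_le
    rw [htop] at hle
    exact hle trivial
  rw [End.mem_maxGenEigenspace] at hu
  simpa using hu

/-- If `[A, A]` acts trivially on an anisotropic module, then homogeneous elements of the graded
ideal `A` act nilpotently. -/
lemma IsAnisotropic.exists_pow [IsAlgClosed K] [NeZero (2 : K)] [FiniteDimensional K U]
    (hM : M.IsAnisotropic) {A : Submodule K g} (hA : L.IsGradedIdeal A)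
    (hAA : ∀ x ∈ A, ∀ y ∈ A, M.act (L.bracket x y) = 0) {i : ZMod 2} {a : g} (haA : a ∈ A)
    (ha : a ∈ L.gr i) (u : U) : ∃ k, (M.act a ^ k) u = 0 := by
  rcases deg_cases i with rfl | rfl
  · exact hM.exists_pow_even hA hAA haA ha u
  · refine ⟨2, ?_⟩
    -- For odd `a` the bracket `[a, a]` acts as twice the square of `a`.
    have h := M.act_bracket 1 1 a ha a ha u
    rw [hAA a haA a haA, koszulSign_one_one, neg_one_smul, sub_neg_eq_add, LinearMap.zero_apply,
      ← two_smul K] at h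
    rw [pow_two, Module.End.mul_apply]
    exact (smul_eq_zero.mp h.symm).resolve_left two_ne_zero

lemma act_act_of_bracket_eq_zero {A : Submodule K g}
    (hAA : ∀ x ∈ A, ∀ y ∈ A, M.act (L.bracket x y) = 0) {i j : ZMod 2} {a b : g} (haA : a ∈ A)
    (ha : a ∈ L.gr i) (hbA : b ∈ A) (hb : b ∈ L.gr j) (u : U) :
    M.act a (M.act b u) = koszulSign K i j • M.act b (M.act a u) := by
  have h := M.act_bracket i j a ha b hb u
  rw [hAA a haA b hbA] at h
  exact sub_eq_zero.mp h.symm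

/-- Supercommuting nilpotent operators have a common kernel vector in each nonzero invariant
subspace. -/
lemma exists_ne_zero_act_eq_zero [FiniteDimensional K U] {A : Submodule K g}
    (hA : L.IsGradedSubspace A)
    (hAA : ∀ x ∈ A, ∀ y ∈ A, M.act (L.bracket x y) = 0)
    (hnil : ∀ i, ∀ a ∈ A, a ∈ L.gr i → ∀ u, ∃ k, (M.act a ^ k) u = 0)
    {Q : Submodule K U} (hQ : Q ≠ ⊥) (hAQ : ∀ a ∈ A, ∀ u ∈ Q, M.act a u ∈ Q) :
    ∃ u ∈ Q, u ≠ 0 ∧ ∀ a ∈ A, M.act a u = 0 := by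
  -- A minimal nonzero `A`-stable subspace `P` of `Q` is killed by `A`: by supercommutation `a P` is
  -- again `A`-stable for homogeneous `a`, so it is zero or all of `P`.
  obtain ⟨P, hP⟩ := exists_minimal_of_wellFoundedLT
    (fun P : Submodule K U => P ≠ ⊥ ∧ P ≤ Q ∧ ∀ a ∈ A, ∀ u ∈ P, M.act a u ∈ P)
    ⟨Q, hQ, le_rfl, hAQ⟩
  obtain ⟨⟨hP0, hPQ, hAP⟩, hmin⟩ := hP
  obtain ⟨u, huP, hu0⟩ := Submodule.exists_mem_ne_zero_of_ne_bot hP0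
  refine ⟨u, hPQ huP, hu0, ?_⟩
  have key : ∀ i, ∀ a ∈ A, a ∈ L.gr i → M.act a u = 0 := by
    intro i a haA ha
    by_contra hau
    have himage : P ≤ P.map (M.act a) := by
      refine hmin ⟨?_, ?_, ?_⟩ ?_
      · intro h
        exact hau ((Submodule.mem_bot K).mp (h ▸ Submodule.mem_map_of_mem huP))
      · rintro _ ⟨v, hv, rfl⟩
        exact hPQ (hAP a haA v hv)
      · rintro b hbA _ ⟨v, hv, rfl⟩
        have hh : ∀ j, M.act (L.proj j b) (M.act a v) ∈ P.map (M.act a) := by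
          intro j
          have hjA := hA.proj_mem hbA j
          rw [act_act_of_bracket_eq_zero hAA hjA (L.proj_mem j b) haA ha]
          exact Submodule.smul_mem _ _ (Submodule.mem_map_of_mem (hAP _ hjA v hv))
        rw [← L.proj_add_proj b, map_add, LinearMap.add_apply]
        exact add_mem (hh 0) (hh 1)
      · rintro _ ⟨v, hv, rfl⟩
        exact hAP a haA v hv
    -- The operator is onto `P`, hence injective on `P`, contradicting nilpotency.
    have hmaps : ∀ v ∈ P, M.act a v ∈ P := hAP a haA
    have hsurj : Function.Surjective ((M.act a).restrict hmaps) := by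
      rintro ⟨w, hw⟩
      obtain ⟨v, hv, rfl⟩ := himage hw
      exact ⟨⟨v, hv⟩, rfl⟩
    have hinj := LinearMap.injective_iff_surjective.mpr hsurj
    have hpow : ∀ k, ∀ v ∈ P, (M.act a ^ k) v = 0 → v = 0 := by
      intro k
      induction k with
      | zero => intro v _ h; simpa using h
      | succ k ih =>
        intro v hv h
        rw [pow_succ] at h
        have h1 := ih _ (hmaps v hv) h
        have h2 : (M.act a).restrict hmaps ⟨v, hv⟩ = (M.act a).restrict hmaps 0 :=
          Subtype.ext (by simpa using h1)
        simpa using congrArg Subtype.val (hinj h2)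
    obtain ⟨k, hk⟩ := hnil i a haA ha u
    exact hu0 (hpow k u huP hk)
  intro a haA
  rw [← L.proj_add_proj a, map_add, LinearMap.add_apply, key 0 _ (hA.proj_mem haA 0) (L.proj_mem 0 a),
    key 1 _ (hA.proj_mem haA 1) (L.proj_mem 1 a), add_zero]

/-- If `[A, A]` acts trivially on an anisotropic module, then so does the graded ideal `A`. -/
lemma IsAnisotropic.act_eq_zero [IsAlgClosed K] [NeZero (2 : K)] [FiniteDimensional K U]
    (hM : M.IsAnisotropic) {A : Submodule K g} (hA : L.IsGradedIdeal A)
    (hAA : ∀ x ∈ A, ∀ y ∈ A, M.act (L.bracket x y) = 0) :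
    ∀ a ∈ A, M.act a = 0 := by
  have hnil : ∀ i, ∀ a ∈ A, a ∈ L.gr i → ∀ u, ∃ k, (M.act a ^ k) u = 0 :=
    fun i a haA ha => hM.exists_pow hA hAA haA ha
  let Q : Submodule K U := Submodule.span K {v | ∃ a ∈ A, ∃ u, v = M.act a u}
  let R : Submodule K U := ⨅ a ∈ A, LinearMap.ker (M.act a)
  have memR : ∀ u, u ∈ R ↔ ∀ a ∈ A, M.act a u = 0 := by
    intro u
    simp [R, Submodule.mem_iInf]
  have memQ : ∀ a ∈ A, ∀ u, M.act a u ∈ Q := fun a ha u => Submodule.subset_span ⟨a, ha, u, rfl⟩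
  have hhomR : ∀ u, (∀ i, ∀ a ∈ A, a ∈ L.gr i → M.act a u = 0) → u ∈ R := by
    intro u h
    rw [memR]
    intro a haA
    rw [← L.proj_add_proj a, map_add, LinearMap.add_apply,
      h 0 _ (hA.1.proj_mem haA 0) (L.proj_mem 0 a),
      h 1 _ (hA.1.proj_mem haA 1) (L.proj_mem 1 a), add_zero]
  have hQle : ∀ S : Submodule K U, (∀ i, ∀ a ∈ A, a ∈ L.gr i → ∀ u, M.act a u ∈ S) → Q ≤ S := by
    intro S hS
    refine Submodule.span_le.mpr ?_
    rintro _ ⟨a, haA, u, rfl⟩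
    rw [← L.proj_add_proj a, map_add, LinearMap.add_apply]
    exact add_mem (hS 0 _ (hA.1.proj_mem haA 0) (L.proj_mem 0 a) u)
      (hS 1 _ (hA.1.proj_mem haA 1) (L.proj_mem 1 a) u)
  -- `Q = A U` and `R = U^A` are graded submodules, and they are orthogonal to each other since `B(a
  -- w, v) = ± B(w, a v) = 0` for `v ∈ R` and homogeneous `a`, `w`. So their intersection is
  -- isotropic.
  have hbot : Q ⊓ R = ⊥ := by
    refine hM _ (fun i u hu => ⟨?_, ?_⟩) (fun y u hu => ⟨?_, ?_⟩) (fun u hu v hv => ?_)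
    · refine hQle (Q.comap (M.proj i)) (fun j a haA ha w => ?_) hu.1
      rw [Submodule.mem_comap, M.act_proj ha]
      exact memQ a haA _
    · refine hhomR _ fun j a haA ha => ?_
      rw [← M.proj_act j i a ha, (memR u).mp hu.2 a haA, map_zero]
    · refine hQle (Q.comap (M.act y)) (fun j a haA ha w => ?_) hu.1
      rw [Submodule.mem_comap]
      refine L.homogeneous_induction (p := fun y => M.act y (M.act a w) ∈ Q)
        (fun x y hx hy => by rw [map_add, LinearMap.add_apply]; exact add_mem hx hy)
        (fun k y hy => ?_) y
      rw [eq_add_of_sub_eq (M.act_bracket k j y hy a ha w).symm]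
      exact add_mem (memQ _ (hA.2.1 y a haA) _) (Submodule.smul_mem _ _ (memQ a haA _))
    · refine hhomR _ fun j a haA ha => ?_
      refine L.homogeneous_induction (p := fun y => M.act a (M.act y u) = 0)
        (fun x y hx hy => by rw [map_add, LinearMap.add_apply, map_add, hx, hy, add_zero])
        (fun k y hy => ?_) y
      have h := M.act_bracket j k a ha y hy u
      rw [(memR u).mp hu.2 a haA, (memR u).mp hu.2 _ (hA.2.2 y a haA), map_zero, smul_zero,
        sub_zero] at h
      exact h.symm
    · refine hQle (LinearMap.ker (M.form.flip v)) (fun j a haA ha w => ?_) hu.1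
      have hk : ∀ k, M.form (M.act a (M.proj k w)) v = 0 := fun k => by
        rw [M.form_act j k a ha, (memR v).mp hv.2 a haA, map_zero, mul_zero, neg_zero]
      change M.form (M.act a w) v = 0
      rw [← M.proj_add_proj w, map_add, map_add,
        LinearMap.add_apply, hk, hk, add_zero]
  have hQ : Q = ⊥ := by
    by_contra hQ
    obtain ⟨u, huQ, hu0, hu⟩ := exists_ne_zero_act_eq_zero hA.1 hAA hnil hQ
      fun a ha u _ => memQ a ha u
    have : u ∈ Q ⊓ R := ⟨huQ, (memR u).mpr hu⟩
    rw [hbot] at this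
    exact hu0 this
  intro a ha
  refine LinearMap.ext fun u => ?_
  have := memQ a ha u
  rw [hQ] at this
  exact this

/-- A solvable Lie superalgebra acts trivially on an anisotropic module. -/
lemma IsAnisotropic.act_eq_zero_of_isSolvable [IsAlgClosed K] [NeZero (2 : K)]
    [FiniteDimensional K U] (hM : M.IsAnisotropic) (hL : L.IsSolvable) : M.act = 0 := by
  obtain ⟨n, hn⟩ := hL
  -- Descent from `D^n = 0` to `D^0 = g`. The subtraction is truncated, so nothing changes once `m ≥
  -- n`.
  have key : ∀ m, ∀ a ∈ L.derived (n - m), M.act a = 0 := by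
    intro m
    induction m with
    | zero => intro a ha; rw [Nat.sub_zero, hn] at ha; rw [(Submodule.mem_bot K).mp ha, map_zero]
    | succ m ih =>
      by_cases hm : n ≤ m
      · rwa [show n - (m + 1) = n - m by omega]
      · refine hM.act_eq_zero (L.derived_isGradedIdeal _) fun x hx y hy => ih _ ?_
        rw [show n - m = n - (m + 1) + 1 by omega]
        exact Submodule.subset_span ⟨x, hx, y, hy, rfl⟩
  refine LinearMap.ext fun a => key n a ?_
  rw [Nat.sub_self]
  trivial

end OrthosymplecticModule

end OrthosymplecticModule

end LieSuperalgebra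

/-! ### Maximal isotropic graded ideals and the subquotient `W^⊥ / W`. -/

namespace LieSuperalgebra

section LagrangianIdeal

open Module

variable {K : Type*} [Field K] {g : Type*} [AddCommGroup g] [Module K g]
  {L : LieSuperalgebra K g} {B : LinearMap.BilinForm K g}

/-- The action of a quadratic Lie superalgebra on the subquotient `W^⊥ / W`. -/
def orthogonalQuotientAct (hB : L.IsInvariantScalarProduct B) {W : Submodule K g}
    (hW : L.IsGradedIdeal W) :
    g →ₗ[K] End K (leftOrthogonal B W ⧸ W.submoduleOf (leftOrthogonal B W)) where
  toFun x := Submodule.mapQ _ _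
    ((L.bracket x).restrict fun y hy => (hB.leftOrthogonal_isGradedIdeal hW).2.1 x y hy)
    (fun y hy => hW.2.1 x y hy)
  map_add' x y := by
    apply Submodule.linearMap_qext
    ext z
    simp only [map_add]
    rfl
  map_smul' c x := by
    apply Submodule.linearMap_qext
    ext z
    simp only [map_smul]
    rfl

lemma orthogonalQuotientAct_mk (hB : L.IsInvariantScalarProduct B) {W : Submodule K g}
    (hW : L.IsGradedIdeal W) (x : g) (u : leftOrthogonal B W) :
    orthogonalQuotientAct hB hW x (Submodule.Quotient.mk u) = Submodule.Quotient.mk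
      ⟨L.bracket x u, (hB.leftOrthogonal_isGradedIdeal hW).2.1 x u u.2⟩ := rfl

/-- The projections onto the homogeneous components of the subquotient `W^⊥ / W`. -/
noncomputable def orthogonalQuotientProj (hB : L.IsInvariantScalarProduct B) {W : Submodule K g}
    (hW : L.IsGradedIdeal W) (i : ZMod 2) :
    End K (leftOrthogonal B W ⧸ W.submoduleOf (leftOrthogonal B W)) :=
  Submodule.mapQ _ _
    ((L.proj i).restrict fun _ hy => (hB.leftOrthogonal_isGradedIdeal hW).1.proj_mem hy i)
    (fun _ hy => hW.1.proj_mem hy i)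

lemma orthogonalQuotientProj_mk (hB : L.IsInvariantScalarProduct B) {W : Submodule K g}
    (hW : L.IsGradedIdeal W) (i : ZMod 2) (u : leftOrthogonal B W) :
    orthogonalQuotientProj hB hW i (Submodule.Quotient.mk u) = Submodule.Quotient.mk
      ⟨L.proj i u, (hB.leftOrthogonal_isGradedIdeal hW).1.proj_mem u.2 i⟩ := rfl

/-- The form induced on the subquotient `W^⊥ / W`. -/
def orthogonalQuotientForm (hB : L.IsInvariantScalarProduct B) {W : Submodule K g}
    (hW : L.IsGradedIdeal W) :
    LinearMap.BilinForm K (leftOrthogonal B W ⧸ W.submoduleOf (leftOrthogonal B W)) :=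
  Submodule.liftQ _
    { toFun := fun x => Submodule.liftQ _ (B x ∘ₗ (leftOrthogonal B W).subtype)
        (fun y hy => mem_leftOrthogonal.mp x.2 y hy)
      map_add' := fun x y => by
        apply Submodule.linearMap_qext
        ext z
        exact LinearMap.congr_fun (map_add B (x : g) y) z
      map_smul' := fun c x => by
        apply Submodule.linearMap_qext
        ext z
        exact LinearMap.congr_fun (map_smul B c (x : g)) z }
    (fun x hx => by
      rw [LinearMap.mem_ker]
      apply Submodule.linearMap_qext
      ext z
      exact hB.apply_comm_eq_zero hW.1 (mem_leftOrthogonal.mp z.2) x hx)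

lemma orthogonalQuotientForm_mk (hB : L.IsInvariantScalarProduct B) {W : Submodule K g}
    (hW : L.IsGradedIdeal W) (u v : leftOrthogonal B W) :
    orthogonalQuotientForm hB hW (Submodule.Quotient.mk u) (Submodule.Quotient.mk v)
      = B u v := rfl

/-- The subquotient `W^⊥ / W` of a quadratic Lie superalgebra as a module with invariant form. -/
noncomputable def orthogonalQuotient (hB : L.IsInvariantScalarProduct B) {W : Submodule K g}
    (hW : L.IsGradedIdeal W) :
    L.OrthosymplecticModule (leftOrthogonal B W ⧸ W.submoduleOf (leftOrthogonal B W)) where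
  act := orthogonalQuotientAct hB hW
  proj := orthogonalQuotientProj hB hW
  form := orthogonalQuotientForm hB hW
  proj_add_proj u := by
    obtain ⟨x, rfl⟩ := Submodule.Quotient.mk_surjective _ u
    rw [orthogonalQuotientProj_mk, orthogonalQuotientProj_mk, ← Submodule.Quotient.mk_add]
    exact congrArg (Submodule.Quotient.mk) (Subtype.ext (L.proj_add_proj (x : g)))
  proj_act i j x hx u := by
    obtain ⟨u, rfl⟩ := Submodule.Quotient.mk_surjective _ u
    rw [orthogonalQuotientProj_mk, orthogonalQuotientAct_mk, orthogonalQuotientProj_mk,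
      orthogonalQuotientAct_mk]
    exact congrArg (Submodule.Quotient.mk) (Subtype.ext (proj_bracket hx j (u : g)))
  act_bracket i j x hx y hy u := by
    obtain ⟨u, rfl⟩ := Submodule.Quotient.mk_surjective _ u
    simp only [orthogonalQuotientAct_mk]
    rw [← Submodule.Quotient.mk_smul, ← Submodule.Quotient.mk_sub]
    exact congrArg (Submodule.Quotient.mk) (Subtype.ext (L.bracket_bracket hx hy (u : g)))
  form_proj_left i u v := by
    obtain ⟨u, rfl⟩ := Submodule.Quotient.mk_surjective _ u
    obtain ⟨v, rfl⟩ := Submodule.Quotient.mk_surjective _ v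
    rw [orthogonalQuotientProj_mk, orthogonalQuotientProj_mk, orthogonalQuotientForm_mk,
      orthogonalQuotientForm_mk]
    exact hB.apply_proj_left i (u : g) v
  form_act i j x hx u v := by
    obtain ⟨u, rfl⟩ := Submodule.Quotient.mk_surjective _ u
    obtain ⟨v, rfl⟩ := Submodule.Quotient.mk_surjective _ v
    simp only [orthogonalQuotientAct_mk, orthogonalQuotientProj_mk, orthogonalQuotientForm_mk]
    rw [L.skew i j x hx _ (L.proj_mem j _), map_neg, LinearMap.neg_apply, map_smul,
      LinearMap.smul_apply, hB.invariant, smul_eq_mul]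

/-- A maximal isotropic graded ideal `W` of a solvable quadratic Lie superalgebra contains
`[g, W^⊥]`. -/
lemma bracket_mem_of_maximal [IsAlgClosed K] [NeZero (2 : K)] [FiniteDimensional K g]
    (hB : L.IsInvariantScalarProduct B) (hL : L.IsSolvable) {W : Submodule K g}
    (hW : Maximal (fun W => L.IsGradedIdeal W ∧ IsIsotropic B W) W) (x : g) {y : g}
    (hy : y ∈ leftOrthogonal B W) : L.bracket x y ∈ W := by
  have hWi := hW.1.1
  have hN := hB.leftOrthogonal_isGradedIdeal hWi
  have han : (orthogonalQuotient hB hWi).IsAnisotropic := by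
    intro P hproj hact hiso
    -- The preimage of `P` in `g` is an isotropic graded ideal containing `W`, so it equals `W` by
    -- maximality.
    let P' : Submodule K g := (P.comap (Submodule.mkQ _)).map (leftOrthogonal B W).subtype
    have memP' : ∀ y (hy : y ∈ leftOrthogonal B W), y ∈ P' ↔ Submodule.Quotient.mk ⟨y, hy⟩ ∈ P := by
      intro y hy
      constructor
      · rintro ⟨z, hz, rfl⟩
        exact hz
      · intro h
        exact ⟨⟨y, hy⟩, h, rfl⟩
    have hP'N : P' ≤ leftOrthogonal B W := by
      rintro _ ⟨z, hz, rfl⟩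
      exact z.2
    have hWP' : W ≤ P' := by
      intro y hy
      rw [memP' y (hW.1.2.le_leftOrthogonal hy)]
      rw [(Submodule.Quotient.mk_eq_zero _).mpr (show _ ∈ W.submoduleOf _ from hy)]
      exact zero_mem _
    have hP' : P' ≤ W := by
      refine hW.2 ⟨isGradedIdeal_of_left (isGradedSubspace_of_proj_mem fun i y hy => ?_)
        fun x y hy => ?_, fun y hy z hz => ?_⟩ hWP'
      · exact (memP' _ (hN.1.proj_mem (hP'N hy) i)).mpr
          (hproj i _ ((memP' y (hP'N hy)).mp hy))
      · exact (memP' _ (hN.2.1 x y (hP'N hy))).mpr (hact x _ ((memP' y (hP'N hy)).mp hy))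
      · exact hiso _ ((memP' y (hP'N hy)).mp hy) _ ((memP' z (hP'N hz)).mp hz)
    rw [eq_bot_iff]
    intro u hu
    obtain ⟨⟨u, huN⟩, rfl⟩ := Submodule.Quotient.mk_surjective _ u
    exact (Submodule.Quotient.mk_eq_zero _).mpr (hP' ((memP' u huN).mpr hu))
  have h0 := han.act_eq_zero_of_isSolvable hL
  have h1 := LinearMap.congr_fun (LinearMap.congr_fun h0 x) (Submodule.Quotient.mk ⟨y, hy⟩)
  exact (Submodule.Quotient.mk_eq_zero (W.submoduleOf (leftOrthogonal B W))).mp h1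

/-- Isotropic homogeneous vectors orthogonal to a maximal isotropic graded ideal lie in it. -/
lemma mem_of_maximal (hB : L.IsInvariantScalarProduct B) {W : Submodule K g}
    (hW : Maximal (fun W => L.IsGradedIdeal W ∧ IsIsotropic B W) W)
    (hbr : ∀ x, ∀ y ∈ leftOrthogonal B W, L.bracket x y ∈ W) {i : ZMod 2} {v : g}
    (hv : v ∈ leftOrthogonal B W) (hvi : v ∈ L.gr i) (hvv : B v v = 0) : v ∈ W := by
  have hN := hB.leftOrthogonal_isGradedIdeal hW.1.1
  have hle : W ⊔ Submodule.span K {v} ≤ W := by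
    refine hW.2 ⟨isGradedIdeal_of_left (isGradedSubspace_of_proj_mem fun j y hy => ?_)
        fun x y hy => ?_, fun y hy z hz => ?_⟩ le_sup_left
    · obtain ⟨w, hw, u, hu, rfl⟩ := Submodule.mem_sup.mp hy
      obtain ⟨c, rfl⟩ := Submodule.mem_span_singleton.mp hu
      rw [map_add, map_smul]
      refine add_mem (Submodule.mem_sup_left (hW.1.1.1.proj_mem hw j)) ?_
      by_cases hij : j = i
      · subst hij
        rw [L.proj_of_mem hvi]
        exact Submodule.mem_sup_right hu
      · rw [L.proj_of_mem_ne hij hvi, smul_zero]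
        exact zero_mem _
    -- The ideal property is automatic: `W + K v` lies in `W^⊥`, which `g` maps into `W`.
    · refine Submodule.mem_sup_left (hbr x y ?_)
      exact sup_le hW.1.2.le_leftOrthogonal
        ((Submodule.span_singleton_le_iff_mem _ _).mpr hv) hy
    · obtain ⟨w, hw, u, hu, rfl⟩ := Submodule.mem_sup.mp hy
      obtain ⟨c, rfl⟩ := Submodule.mem_span_singleton.mp hu
      obtain ⟨w', hw', u', hu', rfl⟩ := Submodule.mem_sup.mp hz
      obtain ⟨d, rfl⟩ := Submodule.mem_span_singleton.mp hu'
      simp [hW.1.2 w hw w' hw', hvv, mem_leftOrthogonal.mp hv w' hw',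
        hB.apply_comm_eq_zero hW.1.1.1 (mem_leftOrthogonal.mp hv) w hw]
  exact hle (Submodule.mem_sup_right (Submodule.mem_span_singleton_self v))

/-- A solvable quadratic Lie superalgebra has an isotropic graded ideal `W` which is either
Lagrangian or such that `W^⊥ = W ⊕ K v` with an even vector `v` of norm one. -/
theorem exists_isotropic_gradedIdeal [IsAlgClosed K] [NeZero (2 : K)] [FiniteDimensional K g]
    (hB : L.IsInvariantScalarProduct B) (hL : L.IsSolvable) :
    ∃ W : Submodule K g, L.IsGradedIdeal W ∧ IsIsotropic B W ∧
      (∀ x, ∀ y ∈ leftOrthogonal B W, L.bracket x y ∈ W) ∧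
      (leftOrthogonal B W = W ∨ ∃ v ∈ leftOrthogonal B W, v ∈ L.gr 0 ∧ B v v = 1 ∧
        leftOrthogonal B W ≤ W ⊔ Submodule.span K {v}) := by
  obtain ⟨W, hW⟩ := exists_maximal_of_wellFoundedGT
    (fun W : Submodule K g => L.IsGradedIdeal W ∧ IsIsotropic B W)
    ⟨⊥, isGradedIdeal_of_left (isGradedSubspace_of_proj_mem (by simp)) (by simp), by
      intro x hx y _; simp [(Submodule.mem_bot K).mp hx]⟩
  have hbr := fun x y hy => bracket_mem_of_maximal hB hL hW x (y := y) hy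
  have hN := hB.leftOrthogonal_isGradedIdeal hW.1.1
  refine ⟨W, hW.1.1, hW.1.2, hbr, ?_⟩
  have hodd : ∀ u ∈ leftOrthogonal B W, L.proj 1 u ∈ W := by
    intro u hu
    refine mem_of_maximal hB hW hbr (hN.1.proj_mem hu 1) (L.proj_mem 1 u) ?_
    -- The form is skew on the odd part, so every odd vector is isotropic.
    have h := hB.supersymm 1 1 _ (L.proj_mem 1 u) _ (L.proj_mem 1 u)
    rw [koszulSign_one_one] at h
    have h2 : (2 : K) * B (L.proj 1 u) (L.proj 1 u) = 0 := by linear_combination h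
    exact (mul_eq_zero.mp h2).resolve_left two_ne_zero
  by_cases hNW : leftOrthogonal B W ≤ W
  · exact Or.inl (le_antisymm hNW hW.1.2.le_leftOrthogonal)
  right
  obtain ⟨u, huN, huW⟩ := Set.not_subset.mp hNW
  have hu0W : L.proj 0 u ∉ W := fun h => huW (by
    rw [← L.proj_add_proj u]; exact add_mem h (hodd u huN))
  have hu0N := hN.1.proj_mem huN 0
  have hc : B (L.proj 0 u) (L.proj 0 u) ≠ 0 := fun h =>
    hu0W (mem_of_maximal hB hW hbr hu0N (L.proj_mem 0 u) h)
  obtain ⟨t, ht⟩ := IsAlgClosed.exists_pow_nat_eq (B (L.proj 0 u) (L.proj 0 u)) (n := 2) two_pos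
  have ht0 : t ≠ 0 := by
    rintro rfl
    exact hc (by rw [← ht]; simp)
  let v := t⁻¹ • L.proj 0 u
  have hv0 : v ∈ L.gr 0 := Submodule.smul_mem _ _ (L.proj_mem 0 u)
  have hvN : v ∈ leftOrthogonal B W := Submodule.smul_mem _ _ hu0N
  have hvv : B v v = 1 := by
    simp only [v, map_smul, LinearMap.smul_apply, smul_eq_mul, ← ht]
    field_simp
  refine ⟨v, hvN, hv0, hvv, fun z hz => ?_⟩
  have hz0N := hN.1.proj_mem hz 0
  -- The component of the even part of `z` orthogonal to `v`; it has to be shown to lie in `W`.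
  let z' := L.proj 0 z - B (L.proj 0 z) v • v
  have hz'0 : z' ∈ L.gr 0 := sub_mem (L.proj_mem 0 z) (Submodule.smul_mem _ _ hv0)
  have hz'N : z' ∈ leftOrthogonal B W := sub_mem hz0N (Submodule.smul_mem _ _ hvN)
  have hz'v : B z' v = 0 := by simp [z', hvv]
  have hvz' : B v z' = 0 := by rw [hB.supersymm 0 0 v hv0 z' hz'0, hz'v, mul_zero]
  -- This choice makes `z' + s v` isotropic, hence a member of `W`. Pairing it with `v ∈ W^⊥` then
  -- gives `s = 0`.
  obtain ⟨s, hs⟩ := IsAlgClosed.exists_pow_nat_eq (-B z' z') (n := 2) two_pos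
  have hmem : z' + s • v ∈ W := by
    refine mem_of_maximal hB hW hbr (add_mem hz'N (Submodule.smul_mem _ _ hvN))
      (add_mem hz'0 (Submodule.smul_mem _ _ hv0)) ?_
    simp [hz'v, hvz', hvv]
    linear_combination hs
  have hs0 : s = 0 := by
    have h := hB.apply_comm_eq_zero hW.1.1.1 (mem_leftOrthogonal.mp hvN) _ hmem
    simpa [hz'v, hvv] using h
  rw [hs0, zero_smul, add_zero] at hmem
  have hz : z = z' + L.proj 1 z + B (L.proj 0 z) v • v := by
    conv_lhs => rw [← L.proj_add_proj z]
    simp only [z']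
    abel
  rw [hz]
  exact add_mem (Submodule.mem_sup_left (add_mem hmem (hodd z ‹_›)))
    (Submodule.mem_sup_right (Submodule.smul_mem _ _ (Submodule.mem_span_singleton_self v)))

end LagrangianIdeal

end LieSuperalgebra

/-! ### Lagrangian kernels and `T*`-extensions. -/

namespace LieSuperalgebra

section LagrangianKernel

open Module

variable {K : Type*} [Field K] {m h : Type*} [AddCommGroup m] [Module K m]
  [AddCommGroup h] [Module K h] {M : LieSuperalgebra K m} {B : LinearMap.BilinForm K m}
  {H : LieSuperalgebra K h} {π : m →ₗ[K] h}

lemma map_proj_of_even {φ : m →ₗ[K] h} (hφ : ∀ i, ∀ x ∈ M.gr i, φ x ∈ H.gr i) (i : ZMod 2) (x : m) :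
    φ (M.proj i x) = H.proj i (φ x) := by
  refine M.homogeneous_induction (fun x y hx hy => by simp only [map_add, hx, hy])
    (fun j x hx => ?_) x
  by_cases hij : i = j
  · subst hij
    rw [M.proj_of_mem hx, H.proj_of_mem (hφ i x hx)]
  · rw [M.proj_of_mem_ne hij hx, H.proj_of_mem_ne hij (hφ j x hx), map_zero]

/-- The even part `∑ i, proj i ∘ s ∘ proj i` of any linear section is still a section, because `π`
commutes with the projections. -/
lemma exists_even_section (hπ : ∀ i, ∀ x ∈ M.gr i, π x ∈ H.gr i) (hsurj : Function.Surjective π) :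
    ∃ s : h →ₗ[K] m, (∀ i, ∀ X ∈ H.gr i, s X ∈ M.gr i) ∧ ∀ X, π (s X) = X := by
  obtain ⟨s, hs⟩ := π.exists_rightInverse_of_surjective (LinearMap.range_eq_top.mpr hsurj)
  have hs' : ∀ X, π (s X) = X := LinearMap.congr_fun hs
  have key : ∀ i X, X ∈ H.gr i → (M.proj 0 ∘ₗ s ∘ₗ H.proj 0 + M.proj 1 ∘ₗ s ∘ₗ H.proj 1) X
      = M.proj i (s X) := by
    intro i X hX
    rcases deg_cases i with rfl | rfl
    · simp [H.proj_of_mem hX, H.proj_of_mem_ne (show (1 : ZMod 2) ≠ 0 by decide) hX]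
    · simp [H.proj_of_mem hX, H.proj_of_mem_ne (show (0 : ZMod 2) ≠ 1 by decide) hX]
  refine ⟨M.proj 0 ∘ₗ s ∘ₗ H.proj 0 + M.proj 1 ∘ₗ s ∘ₗ H.proj 1, fun i X hX => ?_,
    fun X => H.homogeneous_induction ?_ (fun i X hX => ?_) X⟩
  · rw [key i X hX]
    exact M.proj_mem i _
  · intro X Y hX hY
    rw [map_add, map_add, hX, hY]
  · rw [key i X hX, map_proj_of_even hπ, hs', H.proj_of_mem hX]

/-- An even surjection with Lagrangian kernel has an even section with isotropic image. -/
lemma exists_isotropic_section [NeZero (2 : K)] [FiniteDimensional K m] [FiniteDimensional K h]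
    (hB : M.IsInvariantScalarProduct B)
    (hπ : ∀ i, ∀ x ∈ M.gr i, π x ∈ H.gr i) (hsurj : Function.Surjective π)
    (hiso : IsIsotropic B (LinearMap.ker π)) (hdim : finrank K m = 2 * finrank K h) :
    ∃ s : h →ₗ[K] m, (∀ i, ∀ X ∈ H.gr i, s X ∈ M.gr i) ∧ (∀ X, π (s X) = X) ∧
      ∀ X Y, B (s X) (s Y) = 0 := by
  obtain ⟨s, hs, hπs⟩ := exists_even_section hπ hsurj
  -- The form pairs the kernel perfectly with `h`: since the kernel is isotropic and complementary
  -- to the image of `s`, non-degeneracy gives injectivity, and `hdim` gives equal dimensions.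
  let β : LinearMap.ker π →ₗ[K] Dual K h :=
    (B.compl₂ s) ∘ₗ (LinearMap.ker π).subtype
  have hβ : ∀ k X, β k X = B k (s X) := fun _ _ => rfl
  have hinj : Function.Injective β := by
    rw [← LinearMap.ker_eq_bot, LinearMap.ker_eq_bot']
    intro k hk
    refine Subtype.ext (hB.nondegenerate.1 _ fun x => ?_)
    have hx : x - s (π x) ∈ LinearMap.ker π := by simp [hπs]
    have h1 := hiso k k.2 _ hx
    have h2 : B k (s (π x)) = 0 := LinearMap.congr_fun hk (π x)
    rwa [map_sub, h2, sub_zero] at h1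
  have hfin : finrank K (LinearMap.ker π) = finrank K (Dual K h) := by
    have h1 := LinearMap.finrank_range_add_finrank_ker π
    rw [LinearMap.range_eq_top.mpr hsurj, finrank_top] at h1
    rw [Subspace.dual_finrank_eq]
    omega
  let β' := β.linearEquivOfInjective hinj hfin
  -- `ψ X` is the kernel element representing the functional `B(s X, s ·)`. Subtracting half of it
  -- from `s X` removes the form on the image: each of the two cross terms contributes `-1/2 B(s X,
  -- s Y)`, and the term in `ψ X`, `ψ Y` vanishes.
  let ψ : h →ₗ[K] m := (LinearMap.ker π).subtype ∘ₗ β'.symm.toLinearMap ∘ₗ B.compl₁₂ s s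
  have hψker : ∀ X, ψ X ∈ LinearMap.ker π := fun X => (β'.symm (B.compl₁₂ s s X)).2
  have hψ : ∀ X Y, B (ψ X) (s Y) = B (s X) (s Y) := by
    intro X Y
    have h1 : β' (β'.symm (B.compl₁₂ s s X)) = B.compl₁₂ s s X := β'.apply_symm_apply _
    exact LinearMap.congr_fun h1 Y
  have hψeven : ∀ i, ∀ X ∈ H.gr i, ψ X ∈ M.gr i := by
    intro i X hX
    have hker : M.proj i (ψ X) - ψ X ∈ LinearMap.ker π := by
      rw [LinearMap.mem_ker, map_sub, map_proj_of_even hπ, LinearMap.mem_ker.mp (hψker X)]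
      simp
    -- The functional `B(s X, s ·)` has the degree of `X`, so taking the degree `i` component of `ψ
    -- X` does not change its pairings.
    have h0 : β ⟨_, hker⟩ = 0 := by
      refine LinearMap.ext fun Y => ?_
      rw [hβ, map_sub, LinearMap.sub_apply, hB.apply_proj_left, ← map_proj_of_even hs, hψ, hψ,
        map_proj_of_even hs, ← hB.apply_proj_left, M.proj_of_mem (hs i X hX), sub_self,
        LinearMap.zero_apply]
    have h1 := congrArg Subtype.val (hinj (h0.trans (map_zero β).symm))
    rw [← sub_eq_zero.mp h1]
    exact M.proj_mem i _
  refine ⟨s - (2 : K)⁻¹ • ψ, fun i X hX => ?_, fun X => ?_, ?_⟩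
  · exact sub_mem (hs i X hX) (Submodule.smul_mem _ _ (hψeven i X hX))
  · simp [hπs, LinearMap.mem_ker.mp (hψker X)]
  · intro X Y
    refine H.homogeneous_induction
      (p := fun X => B ((s - (2 : K)⁻¹ • ψ) X) ((s - (2 : K)⁻¹ • ψ) Y) = 0)
      (fun X X' hX hX' => by rw [map_add, map_add, LinearMap.add_apply, hX, hX', add_zero])
      (fun i X hX => ?_) X
    refine H.homogeneous_induction
      (p := fun Y => B ((s - (2 : K)⁻¹ • ψ) X) ((s - (2 : K)⁻¹ • ψ) Y) = 0)
      (fun Y Y' hY hY' => by rw [map_add, map_add, hY, hY', add_zero])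
      (fun j Y hY => ?_) Y
    have h1 : B (s X) (ψ Y) = B (s X) (s Y) := by
      rw [hB.supersymm i j _ (hs i X hX) _ (hψeven j Y hY), hψ,
        ← hB.supersymm i j _ (hs i X hX) _ (hs j Y hY)]
    simp only [LinearMap.sub_apply, LinearMap.smul_apply, map_sub, map_smul, smul_eq_mul, h1, hψ,
      hiso _ (hψker X) _ (hψker Y)]
    field_simp
    ring

/-- A quadratic Lie superalgebra with a surjective homomorphism onto `h` whose kernel is Lagrangian
is isometric to a `T*`-extension of `h`. -/
theorem exists_isIsometric_tStar [NeZero (2 : K)] [FiniteDimensional K m] [FiniteDimensional K h]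
    (hB : M.IsInvariantScalarProduct B)
    (hπ : ∀ i, ∀ x ∈ M.gr i, π x ∈ H.gr i)
    (hπbr : ∀ x y, π (M.bracket x y) = H.bracket (π x) (π y)) (hsurj : Function.Surjective π)
    (hiso : IsIsotropic B (LinearMap.ker π)) (hdim : finrank K m = 2 * finrank K h) :
    ∃ (w : h →ₗ[K] h →ₗ[K] Dual K h) (hw : H.IsSupercyclicCocycle w),
      IsIsometric M B (H.tStar w hw) H.tStarForm := by
  obtain ⟨s, hs, hπs, hss⟩ := exists_isotropic_section hB hπ hsurj hiso hdim
  have hsub : ∀ x, x - s (π x) ∈ LinearMap.ker π := fun x => by simp [hπs]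
  have hkbr : ∀ k ∈ LinearMap.ker π, ∀ x, M.bracket k x ∈ LinearMap.ker π := by
    intro k hk x
    rw [LinearMap.mem_ker] at hk ⊢
    rw [hπbr, hk, map_zero, LinearMap.zero_apply]
  let w : h →ₗ[K] h →ₗ[K] Dual K h := (M.bracket.compl₁₂ s s).compr₂ (B.compl₂ s)
  have hw : ∀ X Y Z, w X Y Z = B (M.bracket (s X) (s Y)) (s Z) := fun _ _ _ => rfl
  -- The image of `s` goes to `h`, since it is isotropic, and the kernel goes to `h^*` through the
  -- form. In these coordinates the `h^*` part of `[s X, s Y]` is `w X Y`.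
  let e : m →ₗ[K] h × Dual K h := π.prod (B.compl₂ s)
  have he : ∀ x, e x = (π x, B.compl₂ s x) := fun _ => rfl
  have hC : ∀ x Z, B.compl₂ s x Z = B x (s Z) := fun _ _ => rfl
  have hCgr : ∀ i, ∀ x ∈ M.gr i, B.compl₂ s x ∈ H.dualGr i := fun i x hx j hj Z hZ =>
    hB.apply_eq_zero hj.symm hx (hs j Z hZ)
  have hsC : ∀ X, B.compl₂ s (s X) = 0 := fun X => LinearMap.ext fun Z => hss X Z
  -- The form is preserved.
  have heform : ∀ x y, H.tStarForm (e x) (e y) = B x y := by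
    intro x y
    refine M.homogeneous_induction (p := fun y => H.tStarForm (e x) (e y) = B x y)
      (fun y y' hy hy' => by simp only [map_add, hy, hy']) (fun j y hy => ?_) y
    refine M.homogeneous_induction (p := fun x => H.tStarForm (e x) (e y) = B x y)
      (fun x x' hx hx' => by simp only [map_add, LinearMap.add_apply, hx, hx'])
      (fun i x hx => ?_) x
    rw [he, he, H.tStarForm_of_mem (hπ i x hx) (hCgr j y hy), hC, hC,
      hB.supersymm j i y hy _ (hs i _ (hπ i x hx)), ← mul_assoc, koszulSign_comm j i,
      koszulSign_mul_self, one_mul]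
    have h1 := hiso _ (hsub x) _ (hsub y)
    have h2 := hss (π x) (π y)
    simp only [map_sub, LinearMap.sub_apply] at h1
    linear_combination h2 - h1
  -- The bracket is preserved.
  have hebr : ∀ x y, e (M.bracket x y) = H.tStarBracket w (e x) (e y) := by
    intro x y
    refine M.homogeneous_induction (p := fun y => e (M.bracket x y) = H.tStarBracket w (e x) (e y))
      (fun y y' hy hy' => by simp only [map_add, hy, hy']) (fun j y hy => ?_) y
    refine M.homogeneous_induction (p := fun x => e (M.bracket x y) = H.tStarBracket w (e x) (e y))
      (fun x x' hx hx' => by simp only [map_add, LinearMap.add_apply, hx, hx'])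
      (fun i x hx => ?_) x
    have hπx := hπ i x hx
    have hπy := hπ j y hy
    rw [he, he, he, H.tStarBracket_of_mem w (hCgr i x hx) hπy]
    refine Prod.ext (hπbr x y) (LinearMap.ext fun Z => ?_)
    simp only [LinearMap.sub_apply, LinearMap.add_apply, LinearMap.smul_apply, hw, hC,
      H.coad_apply_of_mem hπx (hCgr j y hy), H.coad_apply_of_mem hπy (hCgr i x hx), smul_eq_mul]
    have hsbr : ∀ X Y, s (H.bracket X Y) - M.bracket (s X) (s Y) ∈ LinearMap.ker π := fun X Y => by
      simp [hπs, hπbr]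
    -- Isotropy of the image of `s` leaves only the kernel component of `u`, and the isotropic
    -- kernel does not see the difference between `s [X, Y]` and `[s X, s Y]`.
    have hBs : ∀ u X Y, B u (s (H.bracket X Y))
        = B (u - s (π u)) (M.bracket (s X) (s Y)) := by
      intro u X Y
      have h1 := hiso _ (hsub u) _ (hsbr X Y)
      have h2 := hss (π u) (H.bracket X Y)
      simp only [map_sub, LinearMap.sub_apply] at h1 h2 ⊢
      linear_combination h1 + h2
    rw [hBs, hBs, ← hB.invariant, ← hB.invariant]
    have hky : y - s (π y) ∈ M.gr j := sub_mem hy (hs j _ hπy)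
    rw [M.skew j i _ hky _ (hs i _ hπx), koszulSign_comm j i]
    -- Brackets of kernel elements do not contribute: by invariance this pairs two elements of the
    -- isotropic ideal `ker π`.
    have h3 : B (M.bracket (x - s (π x)) (y - s (π y))) (s Z) = 0 := by
      rw [hB.invariant]
      exact hiso _ (hsub x) _ (hkbr _ (hsub y) _)
    simp only [map_sub, map_neg, map_smul, LinearMap.sub_apply, LinearMap.neg_apply,
      LinearMap.smul_apply, smul_eq_mul] at h3 ⊢
    have h4 := koszulSign_mul_self (K := K) i j
    linear_combination h3 + (2 * B (M.bracket (s (π x)) (s (π y))) (s Z) -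
      B (M.bracket (s (π x)) y) (s Z) - B (M.bracket x (s (π y))) (s Z)) * h4
  have hes : ∀ X, e (s X) = (X, 0) := fun X => by rw [he, hπs, hsC]
  have hess : ∀ X Y, e (M.bracket (s X) (s Y)) = (H.bracket X Y, w X Y) := by
    intro X Y
    rw [hebr, hes, hes]
    simp [tStarBracket]
  -- The cocycle summand is the `h^*` component of a double bracket in `m`, so the cocycle identity
  -- is the Jacobi identity of `m` transported by `e`. `tStarBracket` makes sense for any bilinear
  -- `w`, so there is no circularity.
  have hesss : ∀ X Y Z, (e (M.bracket (s X) (M.bracket (s Y) (s Z)))).2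
      = H.coad X (w Y Z) + w X (H.bracket Y Z) := by
    intro X Y Z
    rw [hebr, hess, hes]
    simp [tStarBracket, add_comm]
  have hwc : H.IsSupercyclicCocycle w := by
    refine ⟨fun i j X hX Y hY => ?_, fun i j X hX Y hY => ?_, fun i j k X hX Y hY Z hZ => ?_,
      fun i j k X hX Y hY Z hZ => ?_⟩
    · exact hCgr _ _ (M.bracket_mem i j _ (hs i X hX) _ (hs j Y hY))
    · refine LinearMap.ext fun Z => ?_
      rw [hw, M.skew i j _ (hs i X hX) _ (hs j Y hY)]
      simp [hw]
    · have hj := congrArg (fun u => (e u).2)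
        (M.jacobi i j k _ (hs i X hX) _ (hs j Y hY) _ (hs k Z hZ))
      simpa only [map_add, map_smul, Prod.snd_add, Prod.smul_snd, hesss, map_zero,
        Prod.snd_zero] using hj
    · rw [hw, hw, hB.invariant, hB.supersymm i (j + k) _ (hs i X hX) _
        (M.bracket_mem j k _ (hs j Y hY) _ (hs k Z hZ))]
  have heinj : Function.Injective e := by
    rw [← LinearMap.ker_eq_bot, LinearMap.ker_eq_bot']
    intro x hx
    refine hB.nondegenerate.1 x fun y => ?_
    rw [← heform, hx, map_zero, LinearMap.zero_apply]
  have hfin : finrank K m = finrank K (h × Dual K h) := by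
    rw [finrank_prod, Subspace.dual_finrank_eq, hdim, two_mul]
  exact ⟨w, hwc, e.linearEquivOfInjective heinj hfin,
    fun i x hx => ⟨hπ i x hx, hCgr i x hx⟩, hebr, heform⟩

end LagrangianKernel

end LieSuperalgebra

/-! ### Adjoining a line to reach even dimension. -/

namespace LieSuperalgebra

section OddDimension

open Module

variable {K : Type*} [Field K] {g : Type*} [AddCommGroup g] [Module K g]

/-- The direct sum of a Lie superalgebra with a one-dimensional even central ideal. -/
def prodLine (L : LieSuperalgebra K g) : LieSuperalgebra K (g × K) where
  gr i := (L.gr i).prod (if i = 0 then ⊤ else ⊥)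
  isCompl := by
    constructor
    · rw [Submodule.disjoint_def]
      rintro ⟨x, t⟩ ⟨hx, -⟩ ⟨hx', ht⟩
      exact Prod.ext (L.eq_zero_of_mem hx hx') (by simpa using ht)
    · rw [codisjoint_iff, Submodule.eq_top_iff']
      rintro ⟨x, t⟩
      exact Submodule.mem_sup.mpr ⟨(L.proj 0 x, t), ⟨L.proj_mem 0 x, by simp⟩,
        (L.proj 1 x, 0), ⟨L.proj_mem 1 x, by simp⟩, Prod.ext (L.proj_add_proj x) (add_zero t)⟩
  bracket := (L.bracket.compl₁₂ (LinearMap.fst K g K) (LinearMap.fst K g K)).compr₂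
    (LinearMap.inl K g K)
  bracket_mem i j x hx y hy := ⟨L.bracket_mem i j _ hx.1 _ hy.1, zero_mem _⟩
  skew i j x hx y hy := Prod.ext (L.skew i j _ hx.1 _ hy.1) (by simp)
  jacobi i j k x hx y hy z hz := Prod.ext (L.jacobi i j k _ hx.1 _ hy.1 _ hz.1) (by simp)

/-- The orthogonal sum of a form with a line on which the form is `-1`. -/
def prodLineForm (B : LinearMap.BilinForm K g) : LinearMap.BilinForm K (g × K) :=
  B.compl₁₂ (LinearMap.fst K g K) (LinearMap.fst K g K) -
    (LinearMap.mul K K).compl₁₂ (LinearMap.snd K g K) (LinearMap.snd K g K)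

lemma prodLine_bracket (L : LieSuperalgebra K g) (x y : g × K) :
    L.prodLine.bracket x y = (L.bracket x.1 y.1, 0) := rfl

lemma prodLineForm_apply (B : LinearMap.BilinForm K g) (x y : g × K) :
    prodLineForm B x y = B x.1 y.1 - x.2 * y.2 := rfl

variable {L : LieSuperalgebra K g} {B : LinearMap.BilinForm K g}

lemma snd_eq_zero_of_mem_gr_one {x : g × K} (hx : x ∈ L.prodLine.gr 1) : x.2 = 0 := by
  have := hx.2
  simpa using this

lemma IsInvariantScalarProduct.prodLine (hB : L.IsInvariantScalarProduct B) :
    L.prodLine.IsInvariantScalarProduct (prodLineForm B) where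
  supersymm i j x hx y hy := by
    rw [prodLineForm_apply, prodLineForm_apply, hB.supersymm i j _ hx.1 _ hy.1]
    rcases deg_cases i with rfl | rfl
    · simp [mul_comm]
    · rw [snd_eq_zero_of_mem_gr_one hx]
      simp
  even x hx y hy := by
    rw [prodLineForm_apply, hB.even _ hx.1 _ hy.1, snd_eq_zero_of_mem_gr_one hy]
    simp
  nondegenerate := by
    constructor
    · intro x hx
      refine Prod.ext (hB.nondegenerate.1 _ fun y => ?_) ?_
      · simpa [prodLineForm_apply] using hx (y, 0)
      · simpa [prodLineForm_apply] using hx (0, 1)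
    · intro x hx
      refine Prod.ext (hB.nondegenerate.2 _ fun y => ?_) ?_
      · simpa [prodLineForm_apply] using hx (y, 0)
      · simpa [prodLineForm_apply] using hx (0, 1)
  invariant x y z := by
    simp [prodLineForm_apply, prodLine_bracket, hB.invariant]

/-- If `g ⊕ K e` is isometric to `(M, C)`, then `g` is isometric to a non-degenerate graded ideal
of codimension one in `M`. -/
lemma IsIsometric.exists_gradedIdeal [FiniteDimensional K g] {m : Type*} [AddCommGroup m]
    [Module K m] {M : LieSuperalgebra K m} {C : LinearMap.BilinForm K m}
    (hB : L.IsInvariantScalarProduct B) (h : IsIsometric L.prodLine (prodLineForm B) M C) :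
    ∃ (J : Submodule K m) (hJ : M.IsGradedIdeal J), (C.restrict J).Nondegenerate ∧
      finrank K J + 1 = finrank K m ∧ IsIsometric L B (M.restrict J hJ) (C.restrict J) := by
  obtain ⟨e, hgr, hbr, hC⟩ := h
  let f : g →ₗ[K] m := e.toLinearMap ∘ₗ LinearMap.inl K g K
  have hf : ∀ x, f x = e (x, 0) := fun _ => rfl
  have hinj : Function.Injective f := e.injective.comp LinearMap.inl_injective
  have hfgr : ∀ i, ∀ x ∈ L.gr i, f x ∈ M.gr i := fun i x hx => hgr i _ ⟨hx, zero_mem _⟩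
  have hfC : ∀ x y, C (f x) (f y) = B x y := fun x y => by
    rw [hf, hf, hC, prodLineForm_apply]
    simp
  have hfbr : ∀ x y, f (L.bracket x y) = M.bracket (f x) (f y) := fun x y => by
    rw [hf, hf, hf, ← hbr, prodLine_bracket]
  have hJ : M.IsGradedIdeal (LinearMap.range f) := by
    refine isGradedIdeal_of_left (isGradedSubspace_of_proj_mem ?_) ?_
    · rintro i _ ⟨x, rfl⟩
      exact ⟨L.proj i x, map_proj_of_even hfgr i x⟩
    -- Every element of `M` comes from some `(z, t)`, and its line component `t` is central, so
    -- brackets with `g` stay in the image of `g`.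
    · rintro y _ ⟨x, rfl⟩
      obtain ⟨z, rfl⟩ := e.surjective y
      exact ⟨L.bracket z.1 x, by rw [hf, hf, ← hbr, prodLine_bracket]⟩
  refine ⟨LinearMap.range f, hJ, ?_, ?_, LinearEquiv.ofInjective f hinj, ?_, ?_, ?_⟩
  · constructor
    · rintro ⟨_, x, rfl⟩ h0
      refine Subtype.ext ?_
      have : x = 0 := hB.nondegenerate.1 x fun y => by
        rw [← hfC]; exact h0 ⟨f y, y, rfl⟩
      simp [this]
    · rintro ⟨_, x, rfl⟩ h0
      refine Subtype.ext ?_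
      have : x = 0 := hB.nondegenerate.2 x fun y => by
        rw [← hfC]; exact h0 ⟨f y, y, rfl⟩
      simp [this]
  · rw [LinearMap.finrank_range_of_inj hinj, ← e.finrank_eq, finrank_prod, finrank_self]
  · exact fun i x hx => hfgr i x hx
  · exact fun x y => Subtype.ext (hfbr x y)
  · exact fun x y => hfC x y

end OddDimension

end LieSuperalgebra

/-! ### The main theorem. -/

theorem mainTheorem1 {K : Type*} [Field K] [IsAlgClosed K] [CharZero K]
    {g : Type*} [AddCommGroup g] [Module K g] [FiniteDimensional K g]
    (L : LieSuperalgebra K g) (B : LinearMap.BilinForm K g)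
    (hB : L.IsInvariantScalarProduct B) (hL : L.IsSolvable) :
    ∃ (I : Submodule K g) (hI : L.IsGradedIdeal I),
      LieSuperalgebra.IsIsotropic B I ∧
      Module.finrank K I = Module.finrank K g / 2 ∧
      Maximal (fun W : Submodule K g =>
        L.IsGradedSubspace W ∧ LieSuperalgebra.IsIsotropic B W) I ∧
      (Even (Module.finrank K g) →
        ∃ (w : (g ⧸ I) →ₗ[K] (g ⧸ I) →ₗ[K] Module.Dual K (g ⧸ I))
          (hw : (L.quotient I hI).IsSupercyclicCocycle w),
          LieSuperalgebra.IsIsometric L B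
            ((L.quotient I hI).tStar w hw) (L.quotient I hI).tStarForm) ∧
      (Odd (Module.finrank K g) →
        ∃ (w : (g ⧸ I) →ₗ[K] (g ⧸ I) →ₗ[K] Module.Dual K (g ⧸ I))
          (hw : (L.quotient I hI).IsSupercyclicCocycle w)
          (J : Submodule K ((g ⧸ I) × Module.Dual K (g ⧸ I)))
          (hJ : ((L.quotient I hI).tStar w hw).IsGradedIdeal J),
          ((L.quotient I hI).tStarForm.restrict J).Nondegenerate ∧
          Module.finrank K J + 1 = Module.finrank K ((g ⧸ I) × Module.Dual K (g ⧸ I)) ∧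
          LieSuperalgebra.IsIsometric L B
            (((L.quotient I hI).tStar w hw).restrict J hJ)
            ((L.quotient I hI).tStarForm.restrict J)) := by
  obtain ⟨I, hI, hiso, hbr, hcases⟩ := LieSuperalgebra.exists_isotropic_gradedIdeal hB hL
  have hsum := LieSuperalgebra.finrank_leftOrthogonal hB.nondegenerate I
  have hquot := Submodule.finrank_quotient_add_finrank I
  have hle := hiso.two_mul_finrank_le hB.nondegenerate
  -- With `dim I + dim I^⊥ = dim g` and `2 dim I ≤ dim g`, this bound forces `dim I = ⌊dim g / 2⌋`.
  have hrank : Module.finrank K (LieSuperalgebra.leftOrthogonal B I) ≤ Module.finrank K I + 1 := by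
    rcases hcases with h | ⟨v, -, -, -, h⟩
    · rw [h]; omega
    · have h1 := Submodule.finrank_mono h
      have h2 := Submodule.finrank_add_le_finrank_add_finrank I (Submodule.span K {v})
      have h3 := finrank_span_le_card (R := K) ({v} : Set g)
      simp at h3
      omega
  refine ⟨I, hI, hiso, by omega, ⟨⟨hI.1, hiso⟩, fun W hW hIW => ?_⟩, fun heven => ?_, fun hodd => ?_⟩
  -- Maximality is a dimension count: no isotropic subspace has dimension above `⌊dim g / 2⌋`.
  · have := hW.2.two_mul_finrank_le hB.nondegenerate
    exact (Submodule.eq_of_le_of_finrank_le hIW (by omega)).ge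
  · obtain ⟨r, hr⟩ := heven
    refine LieSuperalgebra.exists_isIsometric_tStar (π := I.mkQ) hB (fun i x hx => ⟨x, hx, rfl⟩)
      (fun x y => rfl) I.mkQ_surjective ?_ (by omega)
    rwa [Submodule.ker_mkQ]
  · obtain ⟨r, hr⟩ := hodd
    -- `I^⊥ = I` would make the dimension of `g` even.
    obtain ⟨v, hvN, hv0, hvv, -⟩ := hcases.resolve_left fun h => by rw [h] at hsum; omega
    -- The kernel of this map is `I ⊕ K (v, 1)`, and `(v, 1)` is isotropic because `B(v, v) - 1 =
    -- 0`. It is a homomorphism because `v` is central modulo `I`.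
    let π : g × K →ₗ[K] g ⧸ I := I.mkQ ∘ₗ (LinearMap.fst K g K - (LinearMap.snd K g K).smulRight v)
    have hπ : ∀ x, π x = Submodule.Quotient.mk (x.1 - x.2 • v) := fun _ => rfl
    have hvbr : ∀ x, L.bracket x v ∈ I := fun x => hbr x v hvN
    have hvbr' : ∀ x, L.bracket v x ∈ I := fun x =>
      L.homogeneous_induction (p := fun x => L.bracket v x ∈ I)
        (fun x y hx hy => by rw [map_add]; exact add_mem hx hy)
        (fun i x hx => by
          rw [L.skew 0 i v hv0 x hx]
          exact neg_mem (I.smul_mem _ (hvbr x))) x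
    suffices h : ∃ (w : (g ⧸ I) →ₗ[K] (g ⧸ I) →ₗ[K] Module.Dual K (g ⧸ I))
        (hw : (L.quotient I hI).IsSupercyclicCocycle w),
        LieSuperalgebra.IsIsometric L.prodLine (LieSuperalgebra.prodLineForm B)
          ((L.quotient I hI).tStar w hw) (L.quotient I hI).tStarForm by
      obtain ⟨w, hw, h⟩ := h
      exact ⟨w, hw, h.exists_gradedIdeal hB⟩
    refine LieSuperalgebra.exists_isIsometric_tStar (π := π) hB.prodLine
      (fun i x hx => ?_) (fun x y => ?_) ?_ ?_ ?_
    · refine ⟨x.1 - x.2 • v, sub_mem hx.1 ?_, rfl⟩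
      rcases LieSuperalgebra.deg_cases i with rfl | rfl
      · exact Submodule.smul_mem _ _ hv0
      · rw [LieSuperalgebra.snd_eq_zero_of_mem_gr_one hx, zero_smul]
        exact zero_mem _
    · rw [hπ, hπ, hπ, LieSuperalgebra.quotient_bracket_mk, Submodule.Quotient.eq,
        LieSuperalgebra.prodLine_bracket]
      have : L.bracket x.1 y.1 - (0 : K) • v - L.bracket (x.1 - x.2 • v) (y.1 - y.2 • v)
          = y.2 • L.bracket x.1 v + x.2 • L.bracket v y.1 - (x.2 * y.2) • L.bracket v v := by
        simp only [map_sub, map_smul, LinearMap.sub_apply, LinearMap.smul_apply]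
        module
      rw [this]
      exact sub_mem (add_mem (I.smul_mem _ (hvbr _)) (I.smul_mem _ (hvbr' _)))
        (I.smul_mem _ (hvbr _))
    · intro X
      obtain ⟨x, rfl⟩ := Submodule.Quotient.mk_surjective _ X
      exact ⟨(x, 0), by rw [hπ]; simp⟩
    · intro x hx y hy
      rw [LinearMap.mem_ker, hπ, Submodule.Quotient.mk_eq_zero] at hx hy
      -- Expand `B(x.1 - x.2 v, y.1 - y.2 v) = 0`; the cross terms are evaluated by pairing each
      -- difference, an element of `I`, with `v ∈ I^⊥`.
      have h1 := hiso _ hx _ hy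
      have h2 := LieSuperalgebra.mem_leftOrthogonal.mp hvN _ hy
      have h3 := hB.apply_comm_eq_zero hI.1 (LieSuperalgebra.mem_leftOrthogonal.mp hvN) _ hx
      rw [LieSuperalgebra.prodLineForm_apply]
      simp only [map_sub, map_smul, LinearMap.sub_apply, LinearMap.smul_apply, smul_eq_mul,
        hvv] at h1 h2 h3
      linear_combination h1 + x.2 * h2 + y.2 * h3
    · rw [Module.finrank_prod, Module.finrank_self]
      omega
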